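/- Let $\mathfrak g$ be a finite-dimensional complex semisimple Lie algebra with Killing form $\langle\cdot\,|\,\cdot\rangle$ and adjoint group $G$, endowed with the Lie–Poisson structure $\{F,G\}(y)=\langle y\,|\,[dF(y),dG(y)]\rangle$, where $\mathfrak g$ is identified with $\mathfrak g^*$ by the Killing form. Write $\mathfrak g(y)$ for the centralizer of $y$ in $\mathfrak g$, and $\perp$ for the orthogonal complement with respect to the Killing form. Let $x\in\mathfrak g$ be any element, with Jordan–Chevalley decomposition $x=s+e$ ($s$ semisimple, $e$ nilpotent, $[s,e]=0$). Let $h,f\in\mathfrak g$ satisfy $[h,e]=2e$, $[h,f]=-2f$, $[e,f]=h$ and $[s,h]=[s,f]=0$ (with $h=f=0$ if $e=0$). Let $\mathfrak n_s=\mathfrak g(s)^\perp$, let $\mathfrak n_e$ be any $\operatorname{ad}_h$-invariant complement to $\mathfrak g(x)$ in $\mathfrak g(s)$, and put $\mathfrak n=\mathfrak n_s+\mathfrak n_e$. Then: 1. The sum $\mathfrak n=\mathfrak n_s\oplus\mathfrak n_e$ is direct, $\mathfrak g=\mathfrak g(x)\oplus\mathfrak n$, and $N_x:=x+\mathfrak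 n^\perp$ is a transverse slice at $x$ to the orbit $G\cdot x$, i.e. $\mathfrak g=T_x(G\cdot x)\oplus\mathfrak n^\perp$ with $T_x(G\cdot x)=[\mathfrak g,x]$. 2. $\mathfrak g(x)$ has a basis $(Z_1,\dots,Z_k)$ with $[h,Z_i]=n_iZ_i$, $n_i\in\mathbb Z_{\ge 0}$. 3. For every such basis, the transverse Poisson structure on $N_x$ is, in the linear coordinates $q_i(y)=\langle y-x\,|\,Z_i\rangle$, a polynomial Poisson structure which is quasi-homogeneous of quasi-degree $-2$ with respect to the quasi-degrees $\varpi(q_i)=n_i+2$. Explicitly, let $(X_1,\dots,X_m)$ be any basis of $\mathfrak n$ and put $$A_{ij}(y)=\langle y\,|\,[Z_i,Z_j]\rangle,\qquad B_{ij}(y)=\langle y\,|\,[Z_i,X_j]\rangle,\qquad C_{ij}(y)=\langle y\,|\,[X_i,X_j]\rangle .$$ Then $C(x)$ is invertible, and there is a Poisson bracket $\{\cdot,\cdot\}_N$ on $\mathbb C[q_1,\dots,q_k]$ such that, at every point $y\in N_x$ where $C(y)$ is invertible, $$\bigl(\{q_i,q_j\}_N(y)\bigr)_{i,j}=A(y)+B(y)\,C(y)^{-1}\,B(y)^{\mathsf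 T},$$ which is the Poisson matrix of the transverse Poisson structure (Dirac reduction); and whenever $F,G\in\mathbb C[q_1,\dots,q_k]$ are quasi-homogeneous of quasi-degrees $a$ and $b$ (each $q_i$ having quasi-degree $n_i+2$), the polynomial $\{F,G\}_N$ is quasi-homogeneous of quasi-degree $a+b-2$. -/

import Mathlib

namespace TransversePoisson

/-! ### Lie-theoretic data -/

section LieData

variable {𝔤 : Type*} [LieRing 𝔤] [LieAlgebra ℂ 𝔤]

/-- The centralizer `𝔤(x) = {y | [x, y] = 0}` of an element, as a linear subspace. -/
def centralizer (x : 𝔤) : Submodule ℂ 𝔤 :=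
  LinearMap.ker (LieAlgebra.ad ℂ 𝔤 x : 𝔤 →ₗ[ℂ] 𝔤)

/-- The orthogonal complement `W^⊥` with respect to the Killing form. -/
noncomputable def perp (W : Submodule ℂ 𝔤) : Submodule ℂ 𝔤 :=
  LinearMap.BilinForm.orthogonal (killingForm ℂ 𝔤) W

/-- `x = s + e` is the Jordan-Chevalley decomposition of `x`: `s` is semisimple,
`e` is nilpotent, and they commute. -/
structure IsJordanDecomposition (x s e : 𝔤) : Prop where
  eq_add : x = s + e
  semisimple : Module.End.IsSemisimple (LieAlgebra.ad ℂ 𝔤 s : Module.End ℂ 𝔤)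
  nilpotent : IsNilpotent (LieAlgebra.ad ℂ 𝔤 e : Module.End ℂ 𝔤)
  commute : ⁅s, e⁆ = 0

/-- The relations of an `sl₂`-triple `(h, e, f)`. Unlike `IsSl2Triple`, the zero triple is allowed:
it is the triple that belongs to the nilpotent element `e = 0`. -/
structure IsTriple (h e f : 𝔤) : Prop where
  lie_h_e : ⁅h, e⁆ = (2 : ℂ) • e
  lie_h_f : ⁅h, f⁆ = -((2 : ℂ) • f)
  lie_e_f : ⁅e, f⁆ = h

/-- `𝔫ₑ` is an `ad_h`-invariant subspace of `𝔤(s)` complementary to `𝔤(x)` in `𝔤(s)`. -/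
structure IsInvariantComplement (s x h : 𝔤) (𝔫e : Submodule ℂ 𝔤) : Prop where
  disjoint : Disjoint (centralizer x) 𝔫e
  sup_eq : centralizer x ⊔ 𝔫e = centralizer s
  lie_mem : ∀ u ∈ 𝔫e, ⁅h, u⁆ ∈ 𝔫e

/-- The affine subspace `x + 𝔫^⊥` of `𝔤`. -/
noncomputable def slice (x : 𝔤) (𝔫 : Submodule ℂ 𝔤) : AffineSubspace ℂ 𝔤 :=
  AffineSubspace.mk' x (perp 𝔫)

/-- The tangent space at `x` of the adjoint orbit of `x`: the space `[𝔤, x]` of the velocities at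
`t = 0` of the curves `exp (t ad a) x`, which is also the space of the values at `x` of all
Hamiltonian vector fields of the Lie-Poisson structure. -/
def orbitTangent (x : 𝔤) : Submodule ℂ 𝔤 :=
  LinearMap.range (LieAlgebra.ad ℂ 𝔤 x : 𝔤 →ₗ[ℂ] 𝔤)

/-- An affine subspace `N` is a transverse slice at `x` to the adjoint orbit of `x`:
it passes through `x` and `T_x 𝔤 = T_x (G · x) ⊕ T_x N`. -/
def IsTransverseSlice (x : 𝔤) (N : AffineSubspace ℂ 𝔤) : Prop :=
  x ∈ N ∧ IsCompl (orbitTangent x) N.direction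

/-! ### The Lie-Poisson structure and Dirac reduction -/

/-- The matrix of the Lie-Poisson brackets at `y` of the linear coordinates with differentials
`u i` and `v j`, the Killing form identifying `𝔤` with its dual:
`{F, G}(y) = ⟨y | [dF(y), dG(y)]⟩`. -/
noncomputable def poissonMatrix {ι κ : Type*} (y : 𝔤) (u : ι → 𝔤) (v : κ → 𝔤) : Matrix ι κ ℂ :=
  Matrix.of fun i j => killingForm ℂ 𝔤 y ⁅u i, v j⁆

/-- Dirac's formula `Λ_N(y) = A(y) + B(y) C(y)⁻¹ B(y)ᵀ`, where `A`, `B`, `C` are the blocks of the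
Poisson matrix belonging to `(Z, Z)`, `(Z, X)` and `(X, X)`. It is meaningful where `C(y)` is
invertible. If `X` is a basis of `𝔫` and `Z` a basis of a complement of `𝔫`, it is the Poisson
matrix at `y ∈ x + 𝔫^⊥` of the transverse Poisson structure, in the coordinates
`q_i(y) = ⟨y - x | Z_i⟩`. -/
noncomputable def diracMatrix {k m : ℕ} (y : 𝔤) (Z : Fin k → 𝔤) (X : Fin m → 𝔤) :
    Matrix (Fin k) (Fin k) ℂ :=
  poissonMatrix y Z Z
    + poissonMatrix y Z X * (poissonMatrix y X X)⁻¹ * (poissonMatrix y Z X).transpose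

/-- The linear coordinates `q_i(y) = ⟨y - x | Z_i⟩`, centered at `x`. -/
noncomputable def coord {k : ℕ} (x : 𝔤) (Z : Fin k → 𝔤) (y : 𝔤) : Fin k → ℂ :=
  fun i => killingForm ℂ 𝔤 (y - x) (Z i)

end LieData

/-! ### Polynomial Poisson structures -/

/-- A Poisson bracket on the polynomial algebra `ℂ[q_1, …, q_k]`. -/
structure PolynomialPoisson (k : ℕ) where
  bracket : MvPolynomial (Fin k) ℂ →ₗ[ℂ] MvPolynomial (Fin k) ℂ →ₗ[ℂ] MvPolynomial (Fin k) ℂ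
  skew : ∀ F G, bracket F G = -bracket G F
  leibniz : ∀ F G H, bracket F (G * H) = bracket F G * H + G * bracket F H
  jacobi : ∀ F G H,
    bracket F (bracket G H) + bracket G (bracket H F) + bracket H (bracket F G) = 0

/-- A polynomial Poisson structure is quasi-homogeneous of quasi-degree `d` relative to the
quasi-degrees `ν_i` of the variables: the bracket of quasi-homogeneous polynomials of quasi-degrees
`a` and `b` is quasi-homogeneous of quasi-degree `a + b + d`. -/
def PolynomialPoisson.IsQuasiHomogeneous {k : ℕ} (P : PolynomialPoisson k)
    (ν : Fin k → ℕ) (d : ℤ) : Prop :=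
  ∀ (F G : MvPolynomial (Fin k) ℂ) (a b : ℤ),
    MvPolynomial.IsWeightedHomogeneous (fun i => (ν i : ℤ)) F a →
    MvPolynomial.IsWeightedHomogeneous (fun i => (ν i : ℤ)) G b →
    MvPolynomial.IsWeightedHomogeneous (fun i => (ν i : ℤ)) (P.bracket F G) (a + b + d)

/-- The polynomial Poisson structure `P` is the transverse Poisson structure on `x + 𝔫^⊥`, in the
coordinates `q_i = ⟨· - x | Z_i⟩`, where `X` is a basis of `𝔫`: the block `C` is invertible at `x`,
and at every point of the slice where `C` is invertible (a Zariski open neighbourhood of `x` in the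
slice) the Poisson matrix of `P` is given by Dirac's formula. -/
def PolynomialPoisson.IsTransverse {𝔤 : Type*} [LieRing 𝔤] [LieAlgebra ℂ 𝔤] {k m : ℕ}
    (P : PolynomialPoisson k) (x : 𝔤) (𝔫 : Submodule ℂ 𝔤) (Z : Fin k → 𝔤) (X : Fin m → 𝔤) : Prop :=
  IsUnit (poissonMatrix x X X).det ∧
    ∀ y ∈ slice x 𝔫, IsUnit (poissonMatrix y X X).det → ∀ i j,
      MvPolynomial.eval (coord x Z y) (P.bracket (MvPolynomial.X i) (MvPolynomial.X j))
        = diracMatrix y Z X i j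

end TransversePoisson

/-!
The decomposition `𝔤 = 𝔤(x) ⊕ 𝔫` follows from `𝔤 = 𝔤(s) ⊕ [s, 𝔤]` (`s` is semisimple) and
`𝔤(s)^⊥ = [s, 𝔤]`; taking orthogonal complements gives the transversality of `x + 𝔫^⊥`.
The weight basis of `𝔤(x) ⊆ ker (ad e)` comes from the identity
`E ^ N * F ^ N = N! ∏ i < N, (H - i)` on `ker E`: the left side vanishes for large `N`, so `H` is
annihilated on `ker E` by a product of distinct linear factors with roots in `ℕ`
(`exists_aeval_prod_eq_zero`).

For the Poisson structure, one works in `L = ℂ[q] ⊗ 𝔤` with the generic point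
`y = x + ∑ i, q i • W i` of the slice, `W` being the basis of `𝔫^⊥` dual to `Z`. Instead of
manipulating Dirac's matrix, one lifts the coordinate `q i` to the unique `ξ i ∈ Z i + 𝔫` with
`⟨y | [ξ i, 𝔫]⟩ = 0` (`IsTangentLift`). Dirac's formula is `Λ i j = ⟨y | [ξ i, ξ j]⟩`
(`diracMatrix_eq_of_lie_eq_zero`). For every derivation `D` of `ℂ[q]`, acting on coefficients,
`D (Λ i j) = ⟨D y | [ξ i, ξ j]⟩`, because `D (ξ i)` has values in `𝔫`
(`IsTangentLift.derivation_liftMatrix`). Two derivations matter.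

* The Hamiltonian derivation of `q i` moves the generic point by `[y, ξ i]`, so the Jacobi identity
  of the bracket is the Jacobi identity of `L` (`liftMatrix_jacobi`).
* The Euler derivation `E` with weights `n i + 2` satisfies `E y = 2 (y - s) - [h, y]`, so that
  `E (Λ i j) = (n i + n j + 2) Λ i j` (`derivation_liftMatrix_of_weight`); this is
  quasi-homogeneity.

It remains to see that the `ξ i` have polynomial coefficients. The slice lies in `𝔤(s)`, which makes
`[s, 𝔤]` and `𝔤(s)` orthogonal for `⟨y | [·, ·]⟩`. Hence only the block on `𝔫e` has to be inverted
(`exists_isTangentLift`). Its determinant is an eigenvector of `E`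
(`exists_derivation_det_coeffPoissonMatrix`) and does not vanish at `x`; all weights being positive,
it is a nonzero constant (`isUnit_of_euler`).
-/

namespace TransversePoisson

/-! ### Orthogonality for the Killing form -/

section KillingForm

variable {𝔤 : Type*} [LieRing 𝔤] [LieAlgebra ℂ 𝔤]

lemma killingForm_lie (u v w : 𝔤) :
    killingForm ℂ 𝔤 ⁅u, v⁆ w = killingForm ℂ 𝔤 u ⁅v, w⁆ :=
  LieModule.traceForm_apply_lie_apply ℂ 𝔤 𝔤 u v w

lemma killingForm_comm (u v : 𝔤) : killingForm ℂ 𝔤 u v = killingForm ℂ 𝔤 v u :=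
  LieModule.traceForm_comm ℂ 𝔤 𝔤 u v

lemma killingForm_isRefl : (killingForm ℂ 𝔤).IsRefl :=
  (LieModule.traceForm_isSymm ℂ 𝔤 𝔤).isRefl

lemma mem_centralizer {x u : 𝔤} : u ∈ centralizer x ↔ ⁅x, u⁆ = 0 := Iff.rfl

lemma mem_perp {W : Submodule ℂ 𝔤} {u : 𝔤} :
    u ∈ perp W ↔ ∀ v ∈ W, killingForm ℂ 𝔤 v u = 0 := Iff.rfl

/-- If `W` is invariant under `ad h`, then so is `W^⊥`. -/
lemma lie_mem_perp {W : Submodule ℂ 𝔤} {h : 𝔤} (hW : ∀ u ∈ W, ⁅h, u⁆ ∈ W) {u : 𝔤}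
    (hu : u ∈ perp W) : ⁅h, u⁆ ∈ perp W := by
  intro v hv
  rw [← killingForm_lie, ← lie_skew, map_neg, LinearMap.neg_apply, hu _ (hW v hv), neg_zero]

lemma disjoint_centralizer_orbitTangent {s : 𝔤}
    (hs : Module.End.IsSemisimple (LieAlgebra.ad ℂ 𝔤 s : Module.End ℂ 𝔤)) :
    Disjoint (centralizer s) (orbitTangent s) := by
  rw [Submodule.disjoint_def]
  rintro _ hu ⟨w, rfl⟩
  have h2 := hs.isFinitelySemisimple.genEigenspace_eq_eigenspace 0 (k := 2) (by norm_num)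
  have hw : w ∈ (LieAlgebra.ad ℂ 𝔤 s : Module.End ℂ 𝔤).genEigenspace 0 (2 : ℕ) := by
    rw [Module.End.mem_genEigenspace_nat]
    simpa [pow_two] using mem_centralizer.1 hu
  have hw' : w ∈ (LieAlgebra.ad ℂ 𝔤 s : Module.End ℂ 𝔤).eigenspace 0 := by
    rw [← h2]; exact hw
  simpa using Module.End.mem_eigenspace_iff.1 hw'

variable [FiniteDimensional ℂ 𝔤] [LieAlgebra.IsSemisimple ℂ 𝔤]

lemma killingForm_nondegenerate : (killingForm ℂ 𝔤).Nondegenerate :=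
  LieAlgebra.IsKilling.killingForm_nondegenerate ℂ 𝔤

lemma eq_zero_of_killingForm_right {u : 𝔤} (h : ∀ v, killingForm ℂ 𝔤 u v = 0) : u = 0 :=
  killingForm_nondegenerate.1 u h

lemma perp_perp (W : Submodule ℂ 𝔤) : perp (perp W) = W :=
  LinearMap.BilinForm.orthogonal_orthogonal killingForm_nondegenerate killingForm_isRefl W

lemma perp_orbitTangent (x : 𝔤) : perp (orbitTangent x) = centralizer x := by
  ext u
  rw [mem_perp, mem_centralizer]
  constructor
  · intro h
    refine eq_zero_of_killingForm_right fun v => ?_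
    have := h ⁅x, v⁆ ⟨v, rfl⟩
    rw [killingForm_comm, ← killingForm_lie, ← lie_skew, map_neg, LinearMap.neg_apply,
      neg_eq_zero] at this
    exact this
  · rintro h _ ⟨v, rfl⟩
    change killingForm ℂ 𝔤 ⁅x, v⁆ u = 0
    rw [← lie_skew, map_neg, LinearMap.neg_apply, killingForm_lie, h, map_zero, neg_zero]

lemma perp_centralizer (x : 𝔤) : perp (centralizer x) = orbitTangent x := by
  rw [← perp_orbitTangent, perp_perp]

/-- Passing to orthogonal complements preserves direct sum decompositions of `𝔤`. -/
lemma isCompl_perp {V W : Submodule ℂ 𝔤} (h : IsCompl V W) : IsCompl (perp V) (perp W) := by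
  have key : ∀ {V W : Submodule ℂ 𝔤}, Codisjoint V W → Disjoint (perp V) (perp W) := by
    intro V W hVW
    rw [Submodule.disjoint_def]
    intro u hV hW
    refine eq_zero_of_killingForm_right fun v => ?_
    obtain ⟨a, ha, b, hb, rfl⟩ := Submodule.mem_sup.1
      (hVW.eq_top.symm ▸ Submodule.mem_top : v ∈ V ⊔ W)
    rw [killingForm_comm, map_add, LinearMap.add_apply, hV a ha, hW b hb, add_zero]
  refine ⟨key h.codisjoint, ?_⟩
  have hle : perp (perp V ⊔ perp W) ≤ V ⊓ W :=
    le_inf ((LinearMap.BilinForm.orthogonal_le le_sup_left).trans (perp_perp V).le)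
      ((LinearMap.BilinForm.orthogonal_le le_sup_right).trans (perp_perp W).le)
  rw [h.inf_eq_bot, le_bot_iff] at hle
  rw [codisjoint_iff, ← perp_perp (perp V ⊔ perp W), hle]
  exact LinearMap.BilinForm.orthogonal_bot

lemma isCompl_centralizer_orbitTangent {s : 𝔤}
    (hs : Module.End.IsSemisimple (LieAlgebra.ad ℂ 𝔤 s : Module.End ℂ 𝔤)) :
    IsCompl (centralizer s) (orbitTangent s) := by
  rw [← perp_centralizer]
  refine (LinearMap.BilinForm.isCompl_orthogonal_iff_disjoint killingForm_isRefl).2 ?_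
  have := disjoint_centralizer_orbitTangent hs
  rwa [← perp_centralizer] at this

end KillingForm

/-! ### Weights on the highest weight vectors of an `sl₂`-representation -/

section Weights

open Module.End Polynomial

variable {V : Type*} [AddCommGroup V] [Module ℂ V] {E F H : Module.End ℂ V}

lemma mul_pow_eq_pow_mul_sub (hHF : H * F - F * H = -((2 : ℂ) • F)) (n : ℕ) :
    H * F ^ n = F ^ n * H - (2 * n : ℂ) • F ^ n := by
  have h1 : H * F = F * H - (2 : ℂ) • F := by rw [sub_eq_iff_eq_add.1 hHF]; abel
  induction n with
  | zero => simp
  | succ n ih =>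
    rw [pow_succ, ← mul_assoc, ih, sub_mul, mul_assoc, h1, mul_sub, smul_mul_assoc,
      mul_smul_comm, ← mul_assoc]
    push_cast
    module

/-- The lowering operator of an `sl₂`-triple is nilpotent: its nonzero powers are eigenvectors of
`ad H` for distinct eigenvalues. -/
lemma exists_pow_eq_zero_of_lie_eq [FiniteDimensional ℂ V]
    (hHF : H * F - F * H = -((2 : ℂ) • F)) : ∃ N : ℕ, F ^ N = 0 := by
  by_contra! hF
  let T : Module.End ℂ (Module.End ℂ V) := LinearMap.mulLeft ℂ H - LinearMap.mulRight ℂ H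
  have hT : ∀ n : ℕ, T.HasEigenvalue (-(2 * n : ℂ)) := by
    intro n
    refine hasEigenvalue_of_hasEigenvector (x := F ^ n) ⟨mem_eigenspace_iff.2 ?_, hF n⟩
    simp only [T, LinearMap.sub_apply, LinearMap.mulLeft_apply, LinearMap.mulRight_apply,
      mul_pow_eq_pow_mul_sub hHF]
    module
  refine Set.infinite_of_injective_forall_mem (f := fun n : ℕ => -(2 * n : ℂ)) ?_ hT
    (finite_hasEigenvalue T)
  intro a b hab
  simpa using hab

lemma raise_mul_lower_pow (hHF : H * F - F * H = -((2 : ℂ) • F)) (hEF : E * F - F * E = H)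
    (n : ℕ) :
    E * F ^ (n + 1) = F ^ (n + 1) * E + ((n : ℂ) + 1) • (F ^ n * (H - (n : ℂ) • 1)) := by
  induction n with
  | zero => simpa [sub_eq_iff_eq_add'] using hEF
  | succ n ih =>
    have h1 : H * F = F * H - (2 : ℂ) • F := by rw [sub_eq_iff_eq_add.1 hHF]; abel
    have h2 : E * F = F * E + H := by rw [sub_eq_iff_eq_add.1 hEF]; abel
    have h3 : (H - (n : ℂ) • 1) * F = F * (H - (n + 2 : ℂ) • 1) := by
      rw [sub_mul, h1, mul_sub, smul_mul_assoc, one_mul, mul_smul_comm, mul_one]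
      module
    rw [pow_succ, ← mul_assoc, ih, add_mul, mul_assoc, h2, smul_mul_assoc, mul_assoc (F ^ n), h3,
      ← mul_assoc (F ^ n), ← pow_succ, mul_add, ← mul_assoc]
    simp only [mul_sub, mul_smul_comm, mul_one]
    push_cast
    module

/-- On the kernel of the raising operator, `H` is annihilated by a product of distinct linear
factors `T - i`, `i ∈ ℕ`, because `E ^ N * F ^ N` acts there as `N! ∏ i < N, (H - i)`. -/
lemma exists_aeval_prod_eq_zero [FiniteDimensional ℂ V]
    (hHE : H * E - E * H = (2 : ℂ) • E) (hHF : H * F - F * H = -((2 : ℂ) • F))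
    (hEF : E * F - F * E = H) :
    ∃ N : ℕ, ∀ v, E v = 0 → aeval H (∏ i ∈ Finset.range N, (X - C (i : ℂ))) v = 0 := by
  have key : ∀ (N : ℕ) (v : V), E v = 0 → (E ^ N * F ^ N) v =
      (N.factorial : ℂ) • aeval H (∏ i ∈ Finset.range N, (X - C (i : ℂ))) v := by
    intro N
    induction N with
    | zero => intro v _; simp
    | succ N ih =>
      intro v hv
      have hv' : E ((H - (N : ℂ) • 1) v) = 0 := by
        have := congrArg (fun g : Module.End ℂ V => g v) hHE
        simp [hv] at this
        simp [hv, this]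
      rw [pow_succ E, mul_assoc, raise_mul_lower_pow hHF hEF, mul_add, LinearMap.add_apply,
        ← mul_assoc, Module.End.mul_apply, hv, map_zero, zero_add, mul_smul_comm, ← mul_assoc,
        LinearMap.smul_apply, Module.End.mul_apply, ih _ hv', Finset.prod_range_succ, map_mul,
        Module.End.mul_apply, smul_smul, Nat.factorial_succ]
      have : aeval H (X - C (N : ℂ)) = H - (N : ℂ) • 1 := by
        simp only [map_sub, aeval_X, aeval_C, Algebra.algebraMap_eq_smul_one]
      rw [this]
      push_cast
      rfl
  obtain ⟨N, hN⟩ := exists_pow_eq_zero_of_lie_eq hHF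
  refine ⟨N, fun v hv => ?_⟩
  have := key N v hv
  rw [hN, mul_zero, LinearMap.zero_apply, eq_comm, smul_eq_zero] at this
  exact this.resolve_left (by exact_mod_cast N.factorial_ne_zero)

lemma coe_aeval_restrict_apply {W : Submodule ℂ V} (hW : ∀ w ∈ W, H w ∈ W) (p : ℂ[X]) (w : W) :
    (aeval (H.restrict hW) p w : V) = aeval H p (w : V) := by
  induction p using Polynomial.induction_on generalizing w with
  | C a => simp [Module.algebraMap_end_apply]
  | add p q hp hq => simp [hp, hq]
  | monomial n a ih =>
    rw [pow_succ, ← mul_assoc]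
    generalize C a * X ^ n = q at ih ⊢
    rw [map_mul, map_mul, Module.End.mul_apply, Module.End.mul_apply, ih,
      aeval_X, aeval_X, LinearMap.coe_restrict_apply]

/-- An endomorphism annihilated by `∏ i < N, (T - i)` is diagonalizable, with eigenvalues in `ℕ`. -/
lemma exists_basis_of_aeval_prod_eq_zero [FiniteDimensional ℂ V] {N : ℕ}
    (hN : aeval H (∏ i ∈ Finset.range N, (X - C (i : ℂ))) = 0) :
    ∃ (k : ℕ) (b : Module.Basis (Fin k) ℂ V) (n : Fin k → ℕ), ∀ i, H (b i) = (n i : ℂ) • b i := by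
  classical
  have hsq : Squarefree (∏ i ∈ Finset.range N, (X - C (i : ℂ))) := by
    refine (separable_prod_X_sub_C_iff'.2 ?_).squarefree
    intro a _ b _ hab
    exact_mod_cast hab
  have hss := isSemisimple_of_squarefree_aeval_eq_zero hsq hN
  let D := DirectSum.isInternal_submodule_of_iSupIndep_of_iSup_eq_top
    H.eigenspaces_iSupIndep hss.iSup_eigenspace_eq_top
  let b := D.collectedBasis fun μ => Module.finBasis ℂ (H.eigenspace μ)
  have : Fintype ((μ : ℂ) × Fin (Module.finrank ℂ (H.eigenspace μ))) :=
    FiniteDimensional.fintypeBasisIndex b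
  let b' := b.reindex (Fintype.equivFin _)
  have hb : ∀ i, ∃ μ : ℂ, H (b' i) = μ • b' i := fun i => by
    refine ⟨((Fintype.equivFin _).symm i).1, mem_eigenspace_iff.1 ?_⟩
    rw [Module.Basis.reindex_apply]
    exact D.collectedBasis_mem _ _
  have hb' : ∀ i, ∃ n : ℕ, H (b' i) = (n : ℂ) • b' i := by
    intro i
    obtain ⟨μ, hμ⟩ := hb i
    have h0 := aeval_apply_of_mem_apply_eq_smul (p := ∏ i ∈ Finset.range N, (X - C (i : ℂ))) hμ
    rw [hN, LinearMap.zero_apply, eq_comm, smul_eq_zero, or_iff_left (b'.ne_zero i), eval_prod,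
      Finset.prod_eq_zero_iff] at h0
    obtain ⟨n, -, hn⟩ := h0
    refine ⟨n, ?_⟩
    rw [eval_sub, eval_X, eval_C, sub_eq_zero] at hn
    rw [hμ, hn]
  choose n hn using hb'
  exact ⟨_, b', n, hn⟩

end Weights

/-! ### The weight basis of `𝔤(x)` -/

section WeightBasis

variable {𝔤 : Type*} [LieRing 𝔤] [LieAlgebra ℂ 𝔤]

lemma lie_mem_centralizer {s h u : 𝔤} (hsh : ⁅s, h⁆ = 0) (hu : u ∈ centralizer s) :
    ⁅h, u⁆ ∈ centralizer s := by
  rw [mem_centralizer] at *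
  rw [leibniz_lie, hsh, hu, zero_lie, lie_zero, add_zero]

lemma exists_weight_basis_centralizer [FiniteDimensional ℂ 𝔤] {x s e h f : 𝔤} (hx : x = s + e)
    (ht : IsTriple h e f) (hsh : ⁅s, h⁆ = 0) (hle : centralizer x ≤ centralizer s) :
    ∃ (k : ℕ) (Z : Module.Basis (Fin k) ℂ (centralizer x)) (n : Fin k → ℕ),
      ∀ i, ⁅h, (Z i : 𝔤)⁆ = (n i : ℂ) • (Z i : 𝔤) := by
  have hker : ∀ u ∈ centralizer x, ⁅e, u⁆ = 0 := by
    intro u hu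
    have h1 := mem_centralizer.1 hu
    rwa [hx, add_lie, mem_centralizer.1 (hle hu), zero_add] at h1
  have hmem : ∀ u ∈ centralizer x, LieAlgebra.ad ℂ 𝔤 h u ∈ centralizer x := by
    intro u hu
    have h1 := lie_mem_centralizer hsh (hle hu)
    rw [mem_centralizer] at h1
    rw [mem_centralizer, LieAlgebra.ad_apply, hx, add_lie, h1, zero_add, leibniz_lie,
      hker u hu, lie_zero, add_zero, ← lie_skew e h, ht.lie_h_e, neg_lie, smul_lie, hker u hu,
      smul_zero, neg_zero]
  have had : ∀ a b : 𝔤, LieAlgebra.ad ℂ 𝔤 a * LieAlgebra.ad ℂ 𝔤 b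
      - LieAlgebra.ad ℂ 𝔤 b * LieAlgebra.ad ℂ 𝔤 a = LieAlgebra.ad ℂ 𝔤 ⁅a, b⁆ := by
    intro a b
    ext u
    simp
  obtain ⟨N, hN⟩ := exists_aeval_prod_eq_zero (E := LieAlgebra.ad ℂ 𝔤 e)
    (F := LieAlgebra.ad ℂ 𝔤 f) (H := LieAlgebra.ad ℂ 𝔤 h)
    (by rw [had, ht.lie_h_e, map_smul]) (by rw [had, ht.lie_h_f, map_neg, map_smul])
    (by rw [had, ht.lie_e_f])
  let T : Module.End ℂ (centralizer x) := (LieAlgebra.ad ℂ 𝔤 h : 𝔤 →ₗ[ℂ] 𝔤).restrict hmem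
  have hT : Polynomial.aeval T
      (∏ i ∈ Finset.range N, (Polynomial.X - Polynomial.C (i : ℂ))) = 0 := by
    refine LinearMap.ext fun u => Subtype.ext ?_
    have := hN u (hker u u.2)
    rw [LinearMap.zero_apply, Submodule.coe_zero, ← this, coe_aeval_restrict_apply]
  obtain ⟨k, Z, n, hZ⟩ := exists_basis_of_aeval_prod_eq_zero hT
  exact ⟨k, Z, n, fun i => congrArg Subtype.val (hZ i)⟩

end WeightBasis

/-! ### Lie algebras with polynomial coefficients -/

section Coefficients

open scoped TensorProduct

variable {𝔤 : Type*} [LieRing 𝔤] [LieAlgebra ℂ 𝔤] {R : Type*} [CommRing R] [Algebra ℂ R]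

/-- The `R`-bilinear extension of the Killing form of `𝔤` to `R ⊗ 𝔤`. -/
noncomputable def coeffForm (R : Type*) (𝔤 : Type*) [LieRing 𝔤] [LieAlgebra ℂ 𝔤] [CommRing R]
    [Algebra ℂ R] : LinearMap.BilinForm R (R ⊗[ℂ] 𝔤) :=
  LinearMap.BilinForm.baseChange R (killingForm ℂ 𝔤)

lemma coeffForm_tmul (a b : R) (u v : 𝔤) :
    coeffForm R 𝔤 (a ⊗ₜ u) (b ⊗ₜ v) = killingForm ℂ 𝔤 u v • (a * b) :=
  LinearMap.BilinForm.baseChange_tmul _ _ _ _ _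

lemma coeffForm_lie (u v w : R ⊗[ℂ] 𝔤) :
    coeffForm R 𝔤 ⁅u, v⁆ w = coeffForm R 𝔤 u ⁅v, w⁆ := by
  induction u using TensorProduct.induction_on with
  | zero => simp
  | add u u' hu hu' => rw [add_lie, map_add, LinearMap.add_apply, hu, hu', map_add,
      LinearMap.add_apply]
  | tmul a u =>
    induction v using TensorProduct.induction_on with
    | zero => simp
    | add v v' hv hv' => rw [lie_add, map_add, LinearMap.add_apply, hv, hv', add_lie, map_add]
    | tmul b v =>
      induction w using TensorProduct.induction_on with
      | zero => simp
      | add w w' hw hw' => rw [lie_add, map_add, map_add, hw, hw']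
      | tmul c w =>
        rw [LieAlgebra.ExtendScalars.bracket_tmul, LieAlgebra.ExtendScalars.bracket_tmul,
          coeffForm_tmul, coeffForm_tmul, killingForm_lie, mul_assoc]

/-- A derivation of `R`, acting on the coefficients of the elements of `R ⊗ 𝔤`. -/
noncomputable def coeffDeriv (𝔤 : Type*) [LieRing 𝔤] [LieAlgebra ℂ 𝔤] (D : Derivation ℂ R R) :
    R ⊗[ℂ] 𝔤 →ₗ[ℂ] R ⊗[ℂ] 𝔤 :=
  D.toLinearMap.rTensor 𝔤

lemma coeffDeriv_tmul (D : Derivation ℂ R R) (a : R) (u : 𝔤) :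
    coeffDeriv 𝔤 D (a ⊗ₜ u) = D a ⊗ₜ u := rfl

lemma coeffDeriv_one_tmul (D : Derivation ℂ R R) (u : 𝔤) :
    coeffDeriv 𝔤 D ((1 : R) ⊗ₜ u) = 0 := by
  rw [coeffDeriv_tmul, D.map_one_eq_zero, TensorProduct.zero_tmul]

lemma coeffDeriv_lie (D : Derivation ℂ R R) (u v : R ⊗[ℂ] 𝔤) :
    coeffDeriv 𝔤 D ⁅u, v⁆ = ⁅coeffDeriv 𝔤 D u, v⁆ + ⁅u, coeffDeriv 𝔤 D v⁆ := by
  induction u using TensorProduct.induction_on with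
  | zero => simp
  | add u u' hu hu' => rw [add_lie, map_add, hu, hu', map_add, add_lie, add_lie]; abel
  | tmul a u =>
    induction v using TensorProduct.induction_on with
    | zero => simp
    | add v v' hv hv' => rw [lie_add, map_add, hv, hv', map_add, lie_add, lie_add]; abel
    | tmul b v =>
      simp only [LieAlgebra.ExtendScalars.bracket_tmul, coeffDeriv_tmul, Derivation.leibniz,
        smul_eq_mul, TensorProduct.add_tmul, mul_comm b]
      abel

lemma derivation_coeffForm (D : Derivation ℂ R R) (u v : R ⊗[ℂ] 𝔤) :
    D (coeffForm R 𝔤 u v) =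
      coeffForm R 𝔤 (coeffDeriv 𝔤 D u) v + coeffForm R 𝔤 u (coeffDeriv 𝔤 D v) := by
  induction u using TensorProduct.induction_on with
  | zero => simp
  | add u u' hu hu' => simp only [map_add, LinearMap.add_apply, hu, hu']; abel
  | tmul a u =>
    induction v using TensorProduct.induction_on with
    | zero => simp
    | add v v' hv hv' => simp only [map_add, hv, hv']; abel
    | tmul b v =>
      simp only [coeffDeriv_tmul, coeffForm_tmul, Derivation.map_smul, Derivation.leibniz,
        smul_eq_mul, smul_add, mul_comm b]
      abel

/-- Specialization of the coefficients of the elements of `R ⊗ 𝔤` along a character of `R`. -/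
noncomputable def coeffEval (𝔤 : Type*) [LieRing 𝔤] [LieAlgebra ℂ 𝔤] (φ : R →ₐ[ℂ] ℂ) :
    R ⊗[ℂ] 𝔤 →ₗ[ℂ] 𝔤 :=
  (TensorProduct.lid ℂ 𝔤).toLinearMap ∘ₗ φ.toLinearMap.rTensor 𝔤

lemma coeffEval_tmul (φ : R →ₐ[ℂ] ℂ) (a : R) (u : 𝔤) :
    coeffEval 𝔤 φ (a ⊗ₜ u) = φ a • u := rfl

lemma coeffEval_lie (φ : R →ₐ[ℂ] ℂ) (u v : R ⊗[ℂ] 𝔤) :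
    coeffEval 𝔤 φ ⁅u, v⁆ = ⁅coeffEval 𝔤 φ u, coeffEval 𝔤 φ v⁆ := by
  induction u using TensorProduct.induction_on with
  | zero => simp
  | add u u' hu hu' => rw [add_lie, map_add, hu, hu', map_add, add_lie]
  | tmul a u =>
    induction v using TensorProduct.induction_on with
    | zero => simp
    | add v v' hv hv' => rw [lie_add, map_add, hv, hv', map_add, lie_add]
    | tmul b v =>
      simp only [LieAlgebra.ExtendScalars.bracket_tmul, coeffEval_tmul, map_mul, smul_lie,
        lie_smul, smul_smul, mul_comm (φ b)]

lemma apply_coeffForm (φ : R →ₐ[ℂ] ℂ) (u v : R ⊗[ℂ] 𝔤) :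
    φ (coeffForm R 𝔤 u v) = killingForm ℂ 𝔤 (coeffEval 𝔤 φ u) (coeffEval 𝔤 φ v) := by
  induction u using TensorProduct.induction_on with
  | zero => simp
  | add u u' hu hu' => simp only [map_add, LinearMap.add_apply, hu, hu']
  | tmul a u =>
    induction v using TensorProduct.induction_on with
    | zero => simp
    | add v v' hv hv' => simp only [map_add, hv, hv']
    | tmul b v =>
      simp only [coeffEval_tmul, coeffForm_tmul, map_smul, LinearMap.smul_apply, smul_eq_mul,
        map_mul]
      ring

lemma eq_zero_of_coeffForm_right [FiniteDimensional ℂ 𝔤] [LieAlgebra.IsSemisimple ℂ 𝔤]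
    {w : R ⊗[ℂ] 𝔤} (hw : ∀ u : 𝔤, coeffForm R 𝔤 w (1 ⊗ₜ u) = 0) : w = 0 := by
  let b := Module.finBasis ℂ 𝔤
  let b' := (killingForm ℂ 𝔤).dualBasis killingForm_nondegenerate b
  obtain ⟨c, rfl⟩ : ∃ c : Fin (Module.finrank ℂ 𝔤) → R, w = ∑ i, c i ⊗ₜ[ℂ] b' i :=
    ⟨(b'.baseChange R).repr w, by
      conv_lhs => rw [← (b'.baseChange R).sum_repr w]
      simp [TensorProduct.smul_tmul']⟩
  refine Finset.sum_eq_zero fun i _ => ?_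
  have := hw (b i)
  simp only [map_sum, LinearMap.sum_apply, coeffForm_tmul, b',
    LinearMap.BilinForm.apply_dualBasis_left] at this
  simp at this
  rw [this, TensorProduct.zero_tmul]

end Coefficients

/-! ### Polynomial Poisson structures from their Poisson matrices -/

section Biderivation

open MvPolynomial

variable {k : ℕ}

/-- The biderivation `{F, G} = ∑ i j, Λ i j * ∂ᵢF * ∂ⱼG` with prescribed matrix `Λ`. -/
noncomputable def matrixBracket (Λ : Fin k → Fin k → MvPolynomial (Fin k) ℂ) :
    MvPolynomial (Fin k) ℂ →ₗ[ℂ] MvPolynomial (Fin k) ℂ →ₗ[ℂ] MvPolynomial (Fin k) ℂ :=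
  ∑ i, ∑ j, ((LinearMap.mul ℂ _).compl₁₂ (LinearMap.mulLeft ℂ (Λ i j) ∘ₗ (pderiv i).toLinearMap)
    (pderiv j).toLinearMap)

variable {Λ : Fin k → Fin k → MvPolynomial (Fin k) ℂ}

lemma matrixBracket_apply (F G : MvPolynomial (Fin k) ℂ) :
    matrixBracket Λ F G = ∑ i, ∑ j, Λ i j * pderiv i F * pderiv j G := by
  simp [matrixBracket, LinearMap.sum_apply]

lemma matrixBracket_X_X (i j : Fin k) : matrixBracket Λ (X i) (X j) = Λ i j := by
  simp [matrixBracket_apply, pderiv_X, Pi.single_apply]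

lemma matrixBracket_skew (hΛ : ∀ i j, Λ i j = -Λ j i) (F G : MvPolynomial (Fin k) ℂ) :
    matrixBracket Λ F G = -matrixBracket Λ G F := by
  rw [matrixBracket_apply, matrixBracket_apply, Finset.sum_comm, ← Finset.sum_neg_distrib]
  refine Finset.sum_congr rfl fun i _ => ?_
  rw [← Finset.sum_neg_distrib]
  refine Finset.sum_congr rfl fun j _ => ?_
  rw [hΛ j i]
  ring

lemma matrixBracket_leibniz (F G H : MvPolynomial (Fin k) ℂ) :
    matrixBracket Λ F (G * H) = matrixBracket Λ F G * H + G * matrixBracket Λ F H := by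
  simp only [matrixBracket_apply, Finset.sum_mul, Finset.mul_sum, ← Finset.sum_add_distrib]
  refine Finset.sum_congr rfl fun i _ => Finset.sum_congr rfl fun j _ => ?_
  rw [Derivation.leibniz, smul_eq_mul, smul_eq_mul]
  ring

/-- The Hamiltonian derivation `{F, ·}`. -/
noncomputable def hamiltonian (Λ : Fin k → Fin k → MvPolynomial (Fin k) ℂ)
    (F : MvPolynomial (Fin k) ℂ) : Derivation ℂ (MvPolynomial (Fin k) ℂ) (MvPolynomial (Fin k) ℂ) :=
  Derivation.mk' (matrixBracket Λ F) fun G H => by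
    rw [matrixBracket_leibniz, smul_eq_mul, smul_eq_mul]
    ring

lemma hamiltonian_apply (F G : MvPolynomial (Fin k) ℂ) :
    hamiltonian Λ F G = matrixBracket Λ F G := rfl

/-- The Jacobiator of a skew biderivation is a derivation in its last argument. -/
lemma jacobiator_eq_zero_of_X (hΛ : ∀ i j, Λ i j = -Λ j i) (F G : MvPolynomial (Fin k) ℂ)
    (h : ∀ l, matrixBracket Λ F (matrixBracket Λ G (X l))
      + matrixBracket Λ G (matrixBracket Λ (X l) F)
      + matrixBracket Λ (X l) (matrixBracket Λ F G) = 0) (H : MvPolynomial (Fin k) ℂ) :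
    matrixBracket Λ F (matrixBracket Λ G H) + matrixBracket Λ G (matrixBracket Λ H F)
      + matrixBracket Λ H (matrixBracket Λ F G) = 0 := by
  have key : ∀ H, matrixBracket Λ F (matrixBracket Λ G H) + matrixBracket Λ G (matrixBracket Λ H F)
      + matrixBracket Λ H (matrixBracket Λ F G)
      = (⁅hamiltonian Λ F, hamiltonian Λ G⁆ - hamiltonian Λ (matrixBracket Λ F G)) H := by
    intro H
    rw [Derivation.sub_apply, Derivation.commutator_apply]
    simp only [hamiltonian_apply]
    rw [matrixBracket_skew hΛ H F, matrixBracket_skew hΛ H (matrixBracket Λ F G), map_neg]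
    abel
  have h0 : ⁅hamiltonian Λ F, hamiltonian Λ G⁆ - hamiltonian Λ (matrixBracket Λ F G) = 0 :=
    derivation_ext fun l => by rw [← key, h l, Derivation.zero_apply]
  rw [key, h0, Derivation.zero_apply]

lemma matrixBracket_jacobi (hΛ : ∀ i j, Λ i j = -Λ j i)
    (h : ∀ i j l, hamiltonian Λ (X i) (Λ j l) + hamiltonian Λ (X j) (Λ l i)
      + hamiltonian Λ (X l) (Λ i j) = 0) (F G H : MvPolynomial (Fin k) ℂ) :
    matrixBracket Λ F (matrixBracket Λ G H) + matrixBracket Λ G (matrixBracket Λ H F)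
      + matrixBracket Λ H (matrixBracket Λ F G) = 0 := by
  -- The Jacobiator is cyclically invariant, so the arguments are replaced by variables in turn.
  refine jacobiator_eq_zero_of_X hΛ F G (fun l => ?_) H
  rw [add_assoc, add_comm]
  refine jacobiator_eq_zero_of_X hΛ G (X l) (fun i => ?_) F
  rw [add_assoc, add_comm]
  refine jacobiator_eq_zero_of_X hΛ (X l) (X i) (fun j => ?_) G
  simpa only [matrixBracket_X_X, hamiltonian_apply] using h l i j

/-- The Poisson structure with Poisson matrix `Λ`. -/
noncomputable def PolynomialPoisson.ofMatrix (Λ : Fin k → Fin k → MvPolynomial (Fin k) ℂ)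
    (hΛ : ∀ i j, Λ i j = -Λ j i)
    (h : ∀ i j l, hamiltonian Λ (X i) (Λ j l) + hamiltonian Λ (X j) (Λ l i)
      + hamiltonian Λ (X l) (Λ i j) = 0) : PolynomialPoisson k where
  bracket := matrixBracket Λ
  skew := matrixBracket_skew hΛ
  leibniz := matrixBracket_leibniz
  jacobi := matrixBracket_jacobi hΛ h

lemma isQuasiHomogeneous_ofMatrix {hΛ : ∀ i j, Λ i j = -Λ j i}
    {h : ∀ i j l, hamiltonian Λ (X i) (Λ j l) + hamiltonian Λ (X j) (Λ l i)
      + hamiltonian Λ (X l) (Λ i j) = 0} (ν : Fin k → ℕ) (d : ℤ)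
    (hd : ∀ i j, IsWeightedHomogeneous (fun i => (ν i : ℤ)) (Λ i j) (ν i + ν j + d)) :
    (PolynomialPoisson.ofMatrix Λ hΛ h).IsQuasiHomogeneous ν d := by
  intro F G a b hF hG
  change IsWeightedHomogeneous _ (matrixBracket Λ F G) _
  rw [matrixBracket_apply]
  refine IsWeightedHomogeneous.sum _ _ _ fun i _ => IsWeightedHomogeneous.sum _ _ _ fun j _ => ?_
  have := ((hd i j).mul (hF.pderiv (n' := a - ν i) (i := i) (by ring))).mul
    (hG.pderiv (n' := b - ν j) (i := j) (by ring))
  convert this using 1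
  ring

end Biderivation

/-! ### The Euler derivation -/

section Euler

open MvPolynomial

variable {k : ℕ} (ν : Fin k → ℕ)

/-- The Euler derivation `∑ i, ν i * q i * ∂ᵢ`. -/
noncomputable def euler : Derivation ℂ (MvPolynomial (Fin k) ℂ) (MvPolynomial (Fin k) ℂ) :=
  mkDerivation ℂ fun i => (ν i : ℂ) • X i

lemma euler_X (i : Fin k) : euler ν (X i) = (ν i : ℂ) • X i := mkDerivation_X _ _ _

lemma euler_monomial (m : Fin k →₀ ℕ) (r : ℂ) :
    euler ν (monomial m r) = (∑ i, (m i * ν i : ℂ)) • monomial m r := by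
  rw [euler, mkDerivation_monomial, Finsupp.sum_fintype _ _ (by simp), Finset.sum_smul,
    Finset.smul_sum]
  refine Finset.sum_congr rfl fun i _ => ?_
  by_cases hi : m i = 0
  · simp [hi]
  · rw [smul_eq_mul, mul_smul_comm, X, monomial_mul, smul_monomial, smul_monomial, smul_monomial,
      tsub_add_cancel_of_le (Finsupp.single_le_iff.2 (Nat.one_le_iff_ne_zero.2 hi))]
    congr 1
    simp only [smul_eq_mul]
    ring

lemma coeff_euler (p : MvPolynomial (Fin k) ℂ) (m : Fin k →₀ ℕ) :
    coeff m (euler ν p) = (∑ i, (m i * ν i : ℂ)) * coeff m p := by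
  induction p using MvPolynomial.induction_on' with
  | monomial u a =>
    rw [euler_monomial, coeff_smul, coeff_monomial, smul_eq_mul]
    split_ifs with h
    · rw [h]
    · simp
  | add p q hp hq => rw [map_add, coeff_add, coeff_add, hp, hq, mul_add]

variable {ν}

/-- Converse of Euler's identity: eigenvectors of the Euler derivation are quasi-homogeneous. -/
lemma isWeightedHomogeneous_of_euler {p : MvPolynomial (Fin k) ℂ} {d : ℤ}
    (h : euler ν p = (d : ℂ) • p) : IsWeightedHomogeneous (fun i => (ν i : ℤ)) p d := by
  intro m hm
  have h1 := congrArg (coeff m) h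
  rw [coeff_euler, coeff_smul, smul_eq_mul] at h1
  have h2 := mul_right_cancel₀ hm h1
  rw [Finsupp.weight_apply, Finsupp.sum_fintype _ _ (by simp)]
  simp only [nsmul_eq_mul]
  exact_mod_cast h2

/-- An eigenvector of an Euler derivation with positive weights is constant if its constant term
does not vanish; in particular it is a unit. -/
lemma isUnit_of_euler (hν : ∀ i, 0 < ν i) {p : MvPolynomial (Fin k) ℂ} {c : ℂ}
    (h : euler ν p = c • p) (h0 : constantCoeff p ≠ 0) : IsUnit p := by
  have hc : c = 0 := by
    have h1 := congrArg (coeff 0) h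
    rw [coeff_euler, coeff_smul, smul_eq_mul, ← constantCoeff_eq] at h1
    simpa [h0] using h1
  have hp : p = C (constantCoeff p) := by
    ext m
    rw [coeff_C]
    split_ifs with hm
    · rw [← hm, constantCoeff_eq]
    · have h1 := congrArg (coeff m) h
      rw [coeff_euler, hc, zero_smul, coeff_zero, mul_eq_zero] at h1
      refine h1.resolve_left fun hs => hm ?_
      have hs' : ∑ i, m i * ν i = 0 := by exact_mod_cast hs
      ext i
      have := (Finset.sum_eq_zero_iff.1 hs') i (Finset.mem_univ i)
      simpa [(hν i).ne', eq_comm] using this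
  rw [hp]
  exact (isUnit_iff_ne_zero.2 h0).map C

end Euler

/-! ### Derivations and determinants -/

section Determinant

open scoped DualNumber
open TrivSqZeroExt

variable {R ι : Type*} [CommRing R] [Algebra ℂ R] [Fintype ι] [DecidableEq ι]

/-- A derivation `D` as the ring homomorphism `a ↦ a + ε D a` into the dual numbers. -/
noncomputable def derivationToDual (D : Derivation ℂ R R) : R →+* R[ε] where
  toFun a := inl a + inr (D a)
  map_one' := by simp
  map_zero' := by simp
  map_add' a b := by ext <;> simp
  map_mul' a b := by ext <;> simp [mul_comm]

/-- If `D M = P M + M Q` with constant matrices `P` and `Q`, then `det M` is an eigenvector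
of `D`. Over the dual numbers `M + ε D M = (1 + ε P) M (1 + ε Q)`. -/
lemma exists_derivation_det_eq_smul (D : Derivation ℂ R R) (M : Matrix ι ι R) (P Q : Matrix ι ι ℂ)
    (h : M.map D = P.map (algebraMap ℂ R) * M + M * Q.map (algebraMap ℂ R)) :
    ∃ c : ℂ, D M.det = c • M.det := by
  have hdet : ∀ N : Matrix ι ι ℂ, (1 + (ε : R[ε]) •
      (N.map (algebraMap ℂ R)).map (inlHom R R)).det = inl 1 + inr (algebraMap ℂ R N.trace) := by
    intro N
    rw [Matrix.det_one_add_smul, pow_two, DualNumber.eps_mul_eps, mul_zero, add_zero]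
    have : ((N.map (algebraMap ℂ R)).map (inlHom R R)).trace
        = inlHom R R (algebraMap ℂ R N.trace) := by
      simp [Matrix.trace]
    rw [this]
    ext <;> simp [Algebra.algebraMap_eq_smul_one]
  have hM : M.map (derivationToDual D) = (1 + (ε : R[ε]) •
      (P.map (algebraMap ℂ R)).map (inlHom R R)) * M.map (inlHom R R) *
      (1 + (ε : R[ε]) • (Q.map (algebraMap ℂ R)).map (inlHom R R)) := by
    have hM1 : M.map (derivationToDual D)
        = M.map (inlHom R R) + (ε : R[ε]) • (M.map D).map (inlHom R R) := by
      ext i j <;> simp [derivationToDual]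
    rw [hM1, h, Matrix.map_add _ (map_add _), Matrix.map_mul, Matrix.map_mul, add_mul, one_mul,
      mul_add (M.map _ + _), mul_one, add_mul, Matrix.smul_mul, Matrix.mul_smul, Matrix.smul_mul,
      Matrix.mul_smul, smul_smul, DualNumber.eps_mul_eps, zero_smul, add_zero, smul_add]
    abel
  have := congrArg Matrix.det hM
  rw [Matrix.det_mul, Matrix.det_mul, hdet, hdet] at this
  change ((derivationToDual D).mapMatrix M).det = _ * ((inlHom R R).mapMatrix M).det * _ at this
  rw [← RingHom.map_det, ← RingHom.map_det] at this
  refine ⟨P.trace + Q.trace, ?_⟩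
  have h2 := congrArg snd this
  simp [derivationToDual] at h2
  rw [h2, add_smul, add_comm]

end Determinant

/-! ### Submodules with polynomial coefficients -/

section CoefficientSubmodule

open scoped TensorProduct

variable {𝔤 : Type*} [LieRing 𝔤] [LieAlgebra ℂ 𝔤] {R : Type*} [CommRing R] [Algebra ℂ R]
  {N : Submodule ℂ 𝔤}

lemma baseChange_induction {p : ∀ u : R ⊗[ℂ] 𝔤, u ∈ N.baseChange R → Prop}
    (zero : p 0 (zero_mem _))
    (add : ∀ u v hu hv, p u hu → p v hv → p (u + v) (add_mem hu hv))
    (tmul : ∀ (r : R) (w : 𝔤) (hw : w ∈ N),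
      p (r ⊗ₜ[ℂ] w) (Submodule.tmul_mem_baseChange_of_mem r hw))
    {u : R ⊗[ℂ] 𝔤} (hu : u ∈ N.baseChange R) : p u hu := by
  have key : ∀ t : R ⊗[ℂ] N, ∃ h, p (N.subtype.baseChange R t) h := by
    intro t
    induction t using TensorProduct.induction_on with
    | zero =>
      simp only [map_zero]
      exact ⟨zero_mem _, zero⟩
    | add t t' h h' =>
      obtain ⟨h, hp⟩ := h
      obtain ⟨h', hp'⟩ := h'
      simp only [map_add]
      exact ⟨add_mem h h', add _ _ h h' hp hp'⟩
    | tmul r w => exact ⟨_, tmul r w w.2⟩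
  obtain ⟨t, rfl⟩ : ∃ t, N.subtype.baseChange R t = u := by
    rwa [Submodule.baseChange] at hu
  exact (key t).2

lemma coeffDeriv_mem_baseChange (D : Derivation ℂ R R) {u : R ⊗[ℂ] 𝔤}
    (hu : u ∈ N.baseChange R) : coeffDeriv 𝔤 D u ∈ N.baseChange R := by
  induction hu using baseChange_induction with
  | zero => rw [map_zero]; exact zero_mem _
  | add u v _ _ hu hv => rw [map_add]; exact add_mem hu hv
  | tmul r w hw => exact Submodule.tmul_mem_baseChange_of_mem _ hw

lemma lie_mem_baseChange {h : 𝔤} (hN : ∀ u ∈ N, ⁅h, u⁆ ∈ N) {u : R ⊗[ℂ] 𝔤}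
    (hu : u ∈ N.baseChange R) : ⁅(1 : R) ⊗ₜ[ℂ] h, u⁆ ∈ N.baseChange R := by
  induction hu using baseChange_induction with
  | zero => rw [lie_zero]; exact zero_mem _
  | add u v _ _ hu hv => rw [lie_add]; exact add_mem hu hv
  | tmul r w hw =>
    rw [LieAlgebra.ExtendScalars.bracket_tmul]
    exact Submodule.tmul_mem_baseChange_of_mem _ (hN w hw)

lemma lie_eq_zero_of_mem_baseChange {s : 𝔤} (hN : N ≤ centralizer s) {u : R ⊗[ℂ] 𝔤}
    (hu : u ∈ N.baseChange R) : ⁅(1 : R) ⊗ₜ[ℂ] s, u⁆ = 0 := by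
  induction hu using baseChange_induction with
  | zero => rw [lie_zero]
  | add u v _ _ hu hv => rw [lie_add, hu, hv, add_zero]
  | tmul r w hw =>
    rw [LieAlgebra.ExtendScalars.bracket_tmul, mem_centralizer.1 (hN hw), TensorProduct.tmul_zero]

lemma coeffEval_mem (φ : R →ₐ[ℂ] ℂ) {u : R ⊗[ℂ] 𝔤} (hu : u ∈ N.baseChange R) :
    coeffEval 𝔤 φ u ∈ N := by
  induction hu using baseChange_induction with
  | zero => rw [map_zero]; exact zero_mem _
  | add u v _ _ hu hv => rw [map_add]; exact add_mem hu hv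
  | tmul r w hw => exact N.smul_mem _ hw

lemma coeffForm_eq_zero_of_mem_baseChange {y ξ : R ⊗[ℂ] 𝔤}
    (hN : ∀ w ∈ N, coeffForm R 𝔤 y ⁅ξ, (1 : R) ⊗ₜ[ℂ] w⁆ = 0) {u : R ⊗[ℂ] 𝔤}
    (hu : u ∈ N.baseChange R) : coeffForm R 𝔤 y ⁅ξ, u⁆ = 0 := by
  induction hu using baseChange_induction with
  | zero => rw [lie_zero, map_zero]
  | add u v _ _ hu hv => rw [lie_add, map_add, hu, hv, add_zero]
  | tmul r w hw =>
    have : r ⊗ₜ[ℂ] w = r • (1 : R) ⊗ₜ[ℂ] w := by rw [TensorProduct.smul_tmul', smul_eq_mul, mul_one]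
    rw [this, lie_smul, map_smul, hN w hw, smul_zero]

end CoefficientSubmodule

/-! ### Lifts of the linear coordinates -/

section Lift

open scoped TensorProduct

variable {𝔤 : Type*} [LieRing 𝔤] [LieAlgebra ℂ 𝔤] {R : Type*} [CommRing R] [Algebra ℂ R]
  {k : ℕ} {𝔫 : Submodule ℂ 𝔤} {y : R ⊗[ℂ] 𝔤} {Z : Fin k → 𝔤} {ξ : Fin k → R ⊗[ℂ] 𝔤}

/-- `ξ i ∈ Z i + 𝔫` (with coefficients in `R`) and `⟨y | [ξ i, 𝔫]⟩ = 0`. The second condition says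
that the vector `[y, ξ i]` is tangent to the slice `x + 𝔫^⊥`. -/
structure IsTangentLift (𝔫 : Submodule ℂ 𝔤) (y : R ⊗[ℂ] 𝔤) (Z : Fin k → 𝔤)
    (ξ : Fin k → R ⊗[ℂ] 𝔤) : Prop where
  sub_mem : ∀ i, ξ i - (1 : R) ⊗ₜ[ℂ] Z i ∈ 𝔫.baseChange R
  form_lie : ∀ i, ∀ u ∈ 𝔫, coeffForm R 𝔤 y ⁅ξ i, (1 : R) ⊗ₜ[ℂ] u⁆ = 0

/-- The matrix `⟨y | [ξ i, ξ j]⟩`. -/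
noncomputable def liftMatrix (y : R ⊗[ℂ] 𝔤) (ξ : Fin k → R ⊗[ℂ] 𝔤) (i j : Fin k) : R :=
  coeffForm R 𝔤 y ⁅ξ i, ξ j⁆

lemma liftMatrix_skew (y : R ⊗[ℂ] 𝔤) (ξ : Fin k → R ⊗[ℂ] 𝔤) (i j : Fin k) :
    liftMatrix y ξ i j = -liftMatrix y ξ j i := by
  rw [liftMatrix, liftMatrix, ← lie_skew, map_neg]

namespace IsTangentLift

lemma form_lie_right (hξ : IsTangentLift 𝔫 y Z ξ) (i : Fin k) {u : R ⊗[ℂ] 𝔤}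
    (hu : u ∈ 𝔫.baseChange R) : coeffForm R 𝔤 y ⁅ξ i, u⁆ = 0 :=
  coeffForm_eq_zero_of_mem_baseChange (hξ.form_lie i) hu

lemma form_lie_left (hξ : IsTangentLift 𝔫 y Z ξ) (i : Fin k) {u : R ⊗[ℂ] 𝔤}
    (hu : u ∈ 𝔫.baseChange R) : coeffForm R 𝔤 y ⁅u, ξ i⁆ = 0 := by
  rw [← lie_skew, map_neg, hξ.form_lie_right i hu, neg_zero]

lemma liftMatrix_eq (hξ : IsTangentLift 𝔫 y Z ξ) (i j : Fin k) :
    liftMatrix y ξ i j = coeffForm R 𝔤 y ⁅ξ i, (1 : R) ⊗ₜ[ℂ] Z j⁆ := by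
  rw [liftMatrix, ← sub_eq_zero, ← map_sub, ← lie_sub]
  exact hξ.form_lie_right i (hξ.sub_mem j)

/-- The variation of the `ξ i` does not contribute to the derivatives of `⟨y | [ξ i, ξ j]⟩`. -/
lemma derivation_liftMatrix (hξ : IsTangentLift 𝔫 y Z ξ) (D : Derivation ℂ R R) (i j : Fin k) :
    D (liftMatrix y ξ i j) = coeffForm R 𝔤 (coeffDeriv 𝔤 D y) ⁅ξ i, ξ j⁆ := by
  have hD : ∀ i, coeffDeriv 𝔤 D (ξ i) ∈ 𝔫.baseChange R := by
    intro i
    have := coeffDeriv_mem_baseChange D (hξ.sub_mem i)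
    rwa [map_sub, coeffDeriv_one_tmul, sub_zero] at this
  rw [liftMatrix, derivation_coeffForm, coeffDeriv_lie, map_add, hξ.form_lie_left j (hD i),
    hξ.form_lie_right i (hD j), add_zero, add_zero]

end IsTangentLift

/-- Uniqueness of tangent lifts where the block `C` is invertible: their Poisson brackets are given
by Dirac's formula. -/
lemma diracMatrix_eq_of_lie_eq_zero {m : ℕ} {y : 𝔤} {Z ξ : Fin k → 𝔤} {X : Fin m → 𝔤}
    (hξ : ∀ i, ξ i - Z i ∈ Submodule.span ℂ (Set.range X))
    (h0 : ∀ i b, killingForm ℂ 𝔤 y ⁅ξ i, X b⁆ = 0) (hC : IsUnit (poissonMatrix y X X).det)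
    (i j : Fin k) : killingForm ℂ 𝔤 y ⁅ξ i, ξ j⁆ = diracMatrix y Z X i j := by
  have hc : ∀ i, ∃ c : Fin m → ℂ, ∑ a, c a • X a = ξ i - Z i := fun i =>
    (Submodule.mem_span_range_iff_exists_fun ℂ).1 (hξ i)
  choose c hc using hc
  have hc' : ∀ i, ξ i = Z i + ∑ a, c i a • X a := fun i => by rw [hc]; abel
  have hBC : poissonMatrix y Z X + Matrix.of c * poissonMatrix y X X = 0 := by
    ext i b
    have := h0 i b
    rw [hc', add_lie, map_add] at this
    simpa [poissonMatrix, Matrix.mul_apply, sum_lie] using this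
  have hc'' : Matrix.of c = -(poissonMatrix y Z X * (poissonMatrix y X X)⁻¹) := by
    rw [eq_neg_of_add_eq_zero_left hBC, Matrix.neg_mul, neg_neg,
      Matrix.mul_nonsing_inv_cancel_right _ _ hC]
  have h1 : killingForm ℂ 𝔤 y ⁅ξ i, ξ j⁆ = killingForm ℂ 𝔤 y ⁅ξ i, Z j⁆ := by
    conv_lhs => rw [hc' j]
    simp [lie_sum, h0]
  have h2 : ∀ a, killingForm ℂ 𝔤 y ⁅X a, Z j⁆ = -(poissonMatrix y Z X).transpose a j := by
    intro a
    rw [← lie_skew, map_neg]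
    rfl
  rw [h1, hc' i, diracMatrix, ← neg_neg (poissonMatrix y Z X * _), ← hc'', Matrix.neg_mul,
    Matrix.add_apply, Matrix.neg_apply, Matrix.mul_apply, ← Finset.sum_neg_distrib]
  simp [sum_lie, h2, poissonMatrix]

end Lift

/-! ### The generic point of the slice -/

section GenericPoint

open scoped TensorProduct

variable {𝔤 : Type*} [LieRing 𝔤] [LieAlgebra ℂ 𝔤] {R : Type*} [CommRing R] [Algebra ℂ R]
  {k : ℕ} {x s e h : 𝔤} {Z W : Fin k → 𝔤} {q : Fin k → R} {D : Derivation ℂ R R}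
  {𝔫 : Submodule ℂ 𝔤} {ξ : Fin k → R ⊗[ℂ] 𝔤} {n : Fin k → ℕ}

/-- The point `x + ∑ i, q i • W i`. It is the generic point of an affine subspace when the `q i` are
the variables of a polynomial ring. -/
noncomputable def affinePoint (x : 𝔤) (W : Fin k → 𝔤) (q : Fin k → R) : R ⊗[ℂ] 𝔤 :=
  1 ⊗ₜ x + ∑ i, q i ⊗ₜ W i

lemma coeffDeriv_affinePoint (D : Derivation ℂ R R) :
    coeffDeriv 𝔤 D (affinePoint x W q) = ∑ i, D (q i) ⊗ₜ W i := by
  rw [affinePoint, map_add, coeffDeriv_one_tmul, zero_add, map_sum]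
  rfl

lemma coeffEval_affinePoint (φ : R →ₐ[ℂ] ℂ) :
    coeffEval 𝔤 φ (affinePoint x W q) = x + ∑ i, φ (q i) • W i := by
  simp [affinePoint, coeffEval_tmul]

/-- If `q i` is an eigenvector of `D` with eigenvalue `n i + 2`, then
`D y = 2 (y - s) - [h, y]` for `y = x + ∑ i, q i • W i`. -/
lemma coeffDeriv_affinePoint_of_weight (hx : x = s + e) (hs : ⁅h, s⁆ = 0)
    (he : ⁅h, e⁆ = (2 : ℂ) • e) (hW : ∀ i, ⁅h, W i⁆ = -((n i : ℂ) • W i))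
    (hD : ∀ i, D (q i) = (n i + 2 : ℂ) • q i) :
    coeffDeriv 𝔤 D (affinePoint x W q) =
      (2 : ℂ) • (affinePoint x W q - 1 ⊗ₜ s) - ⁅(1 : R) ⊗ₜ[ℂ] h, affinePoint x W q⁆ := by
  have hhx : ⁅h, x⁆ = (2 : ℂ) • e := by rw [hx, lie_add, hs, he, zero_add]
  have h1 : ⁅(1 : R) ⊗ₜ[ℂ] h, affinePoint x W q⁆
      = (2 : ℂ) • (1 ⊗ₜ e) - ∑ i, (n i : ℂ) • (q i ⊗ₜ[ℂ] W i) := by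
    rw [affinePoint, lie_add, LieAlgebra.ExtendScalars.bracket_tmul, hhx, lie_sum, mul_one,
      TensorProduct.tmul_smul, sub_eq_add_neg, ← Finset.sum_neg_distrib]
    congr 1
    refine Finset.sum_congr rfl fun i _ => ?_
    rw [LieAlgebra.ExtendScalars.bracket_tmul, hW, one_mul, TensorProduct.tmul_neg,
      TensorProduct.tmul_smul]
  have h2 : affinePoint x W q - 1 ⊗ₜ s = 1 ⊗ₜ e + ∑ i, q i ⊗ₜ[ℂ] W i := by
    rw [affinePoint, hx, TensorProduct.tmul_add]
    abel
  rw [coeffDeriv_affinePoint, h1, h2, smul_add, Finset.smul_sum, add_comm, add_sub_assoc,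
    sub_sub_cancel, ← Finset.sum_add_distrib]
  refine Finset.sum_congr rfl fun i _ => ?_
  rw [hD, ← TensorProduct.smul_tmul', ← add_smul, add_comm]

lemma coeffForm_coeffDeriv_affinePoint (hx : x = s + e) (hs : ⁅h, s⁆ = 0)
    (he : ⁅h, e⁆ = (2 : ℂ) • e) (hW : ∀ i, ⁅h, W i⁆ = -((n i : ℂ) • W i))
    (hD : ∀ i, D (q i) = (n i + 2 : ℂ) • q i) {u : R ⊗[ℂ] 𝔤} (hu : ⁅(1 : R) ⊗ₜ[ℂ] s, u⁆ = 0)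
    (v : R ⊗[ℂ] 𝔤) :
    coeffForm R 𝔤 (coeffDeriv 𝔤 D (affinePoint x W q)) ⁅u, v⁆ =
      (2 : ℂ) • coeffForm R 𝔤 (affinePoint x W q) ⁅u, v⁆
        + coeffForm R 𝔤 (affinePoint x W q) ⁅⁅(1 : R) ⊗ₜ[ℂ] h, u⁆, v⁆
        + coeffForm R 𝔤 (affinePoint x W q) ⁅u, ⁅(1 : R) ⊗ₜ[ℂ] h, v⁆⁆ := by
  have h1 : coeffForm R 𝔤 (1 ⊗ₜ s) ⁅u, v⁆ = 0 := by
    rw [← coeffForm_lie, hu, map_zero, LinearMap.zero_apply]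
  have h2 : coeffForm R 𝔤 ⁅(1 : R) ⊗ₜ[ℂ] h, affinePoint x W q⁆ ⁅u, v⁆
      = -(coeffForm R 𝔤 (affinePoint x W q) ⁅⁅(1 : R) ⊗ₜ[ℂ] h, u⁆, v⁆
        + coeffForm R 𝔤 (affinePoint x W q) ⁅u, ⁅(1 : R) ⊗ₜ[ℂ] h, v⁆⁆) := by
    rw [← lie_skew, map_neg, LinearMap.neg_apply, coeffForm_lie, leibniz_lie, map_add]
  rw [coeffDeriv_affinePoint_of_weight hx hs he hW hD, map_sub, LinearMap.sub_apply, h2,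
    ← algebraMap_smul R (2 : ℂ) (affinePoint x W q - _), map_smul,
    LinearMap.smul_apply, map_sub, LinearMap.sub_apply, h1, sub_zero, algebraMap_smul]
  abel

/-- `⟨y | [ξ i, ξ j]⟩` has weight `n i + n j + 2`, because `[h, ξ i] ∈ n i • ξ i + 𝔫`. -/
lemma derivation_liftMatrix_of_weight (hx : x = s + e) (hs : ⁅h, s⁆ = 0)
    (he : ⁅h, e⁆ = (2 : ℂ) • e) (hW : ∀ i, ⁅h, W i⁆ = -((n i : ℂ) • W i))
    (hD : ∀ i, D (q i) = (n i + 2 : ℂ) • q i)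
    (hZ : ∀ i, ⁅h, Z i⁆ = (n i : ℂ) • Z i) (h𝔫 : ∀ u ∈ 𝔫, ⁅h, u⁆ ∈ 𝔫)
    (hξ : IsTangentLift 𝔫 (affinePoint x W q) Z ξ) (hξs : ∀ i, ⁅(1 : R) ⊗ₜ[ℂ] s, ξ i⁆ = 0)
    (i j : Fin k) :
    D (liftMatrix (affinePoint x W q) ξ i j)
      = (n i + n j + 2 : ℂ) • liftMatrix (affinePoint x W q) ξ i j := by
  have hmem : ∀ i, ⁅(1 : R) ⊗ₜ[ℂ] h, ξ i⁆ - (n i : ℂ) • ξ i ∈ 𝔫.baseChange R := by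
    intro i
    have h1 := lie_mem_baseChange h𝔫 (hξ.sub_mem i)
    rw [lie_sub, LieAlgebra.ExtendScalars.bracket_tmul, hZ, TensorProduct.tmul_smul, one_mul] at h1
    have h2 := Submodule.smul_of_tower_mem _ (n i : ℂ) (hξ.sub_mem i)
    have := sub_mem h1 h2
    rwa [smul_sub, sub_sub_sub_cancel_right] at this
  have hl : ∀ i j, coeffForm R 𝔤 (affinePoint x W q) ⁅ξ i, ⁅(1 : R) ⊗ₜ[ℂ] h, ξ j⁆⁆
      = (n j : ℂ) • liftMatrix (affinePoint x W q) ξ i j := by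
    intro i j
    have := hξ.form_lie_right i (hmem j)
    rw [lie_sub, map_sub, sub_eq_zero] at this
    rw [this, ← algebraMap_smul R (n j : ℂ) (ξ j), lie_smul, map_smul,
      algebraMap_smul, liftMatrix]
  have hl' : coeffForm R 𝔤 (affinePoint x W q) ⁅⁅(1 : R) ⊗ₜ[ℂ] h, ξ i⁆, ξ j⁆
      = (n i : ℂ) • liftMatrix (affinePoint x W q) ξ i j := by
    rw [← lie_skew, map_neg, hl, liftMatrix_skew _ _ j i, smul_neg, neg_neg]
  rw [hξ.derivation_liftMatrix, coeffForm_coeffDeriv_affinePoint hx hs he hW hD (hξs i), hl, hl',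
    ← liftMatrix]
  module

/-- The matrix of the form `⟨y | [·, ·]⟩` in the family `b`. -/
noncomputable def coeffPoissonMatrix {ι : Type*} (y : R ⊗[ℂ] 𝔤) (b : ι → 𝔤) : Matrix ι ι R :=
  Matrix.of fun a c => coeffForm R 𝔤 y ⁅(1 : R) ⊗ₜ[ℂ] b a, (1 : R) ⊗ₜ[ℂ] b c⁆

lemma coeffPoissonMatrix_map {ι : Type*} (φ : R →ₐ[ℂ] ℂ) (y : R ⊗[ℂ] 𝔤) (b : ι → 𝔤) :
    (coeffPoissonMatrix y b).map φ = poissonMatrix (coeffEval 𝔤 φ y) b b := by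
  ext a c
  rw [Matrix.map_apply, coeffPoissonMatrix, Matrix.of_apply, apply_coeffForm, coeffEval_lie,
    coeffEval_tmul, coeffEval_tmul, map_one, one_smul, one_smul]
  rfl

/-- The block of the Poisson matrix that belongs to an `ad h`-invariant subspace of `𝔤(s)` has a
quasi-homogeneous determinant. -/
lemma exists_derivation_det_coeffPoissonMatrix (hx : x = s + e) (hs : ⁅h, s⁆ = 0)
    (he : ⁅h, e⁆ = (2 : ℂ) • e) (hW : ∀ i, ⁅h, W i⁆ = -((n i : ℂ) • W i))
    (hD : ∀ i, D (q i) = (n i + 2 : ℂ) • q i) {p : ℕ}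
    (b : Module.Basis (Fin p) ℂ 𝔫) (h𝔫 : ∀ u ∈ 𝔫, ⁅h, u⁆ ∈ 𝔫) (h𝔫s : 𝔫 ≤ centralizer s) :
    ∃ c : ℂ, D (coeffPoissonMatrix (affinePoint x W q) fun a => (b a : 𝔤)).det
      = c • (coeffPoissonMatrix (affinePoint x W q) fun a => (b a : 𝔤)).det := by
  set M := coeffPoissonMatrix (affinePoint x W q) fun a => (b a : 𝔤) with hM
  let H : Matrix (Fin p) (Fin p) ℂ := Matrix.of fun a c => b.repr ⟨⁅h, (b a : 𝔤)⁆, h𝔫 _ (b a).2⟩ c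
  have hH : ∀ a, ⁅(1 : R) ⊗ₜ[ℂ] h, (1 : R) ⊗ₜ[ℂ] (b a : 𝔤)⁆
      = ∑ c, algebraMap ℂ R (H a c) • (1 : R) ⊗ₜ[ℂ] (b c : 𝔤) := by
    intro a
    have := congrArg Subtype.val (b.sum_repr ⟨⁅h, (b a : 𝔤)⁆, h𝔫 _ (b a).2⟩)
    simp only [Submodule.coe_sum, Submodule.coe_smul] at this
    rw [LieAlgebra.ExtendScalars.bracket_tmul, ← this, TensorProduct.tmul_sum, mul_one]
    simp only [TensorProduct.tmul_smul, algebraMap_smul]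
    rfl
  have hs' : ∀ a, ⁅(1 : R) ⊗ₜ[ℂ] s, (1 : R) ⊗ₜ[ℂ] (b a : 𝔤)⁆ = 0 := fun a =>
    lie_eq_zero_of_mem_baseChange h𝔫s (Submodule.tmul_mem_baseChange_of_mem _ (b a).2)
  have hE : M.map D = ((2 : ℂ) • (1 : Matrix (Fin p) (Fin p) ℂ) + H).map (algebraMap ℂ R) * M
      + M * H.transpose.map (algebraMap ℂ R) := by
    ext1 a c
    have h2 : (((2 : ℂ) • (1 : Matrix (Fin p) (Fin p) ℂ) + H).map (algebraMap ℂ R) * M) a c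
        = (2 : ℂ) • M a c + (H.map (algebraMap ℂ R) * M) a c := by
      rw [Matrix.map_add _ (map_add _), add_mul, Matrix.add_apply]
      congr 1
      rw [Algebra.smul_def (2 : ℂ) (M a c)]
      simp [Matrix.mul_apply, Matrix.one_apply, apply_ite (algebraMap ℂ R)]
    rw [Matrix.add_apply, h2, Matrix.map_apply, hM, coeffPoissonMatrix, Matrix.of_apply,
      derivation_coeffForm, coeffDeriv_lie, coeffDeriv_one_tmul, coeffDeriv_one_tmul, zero_lie,
      lie_zero, add_zero, map_zero, add_zero,
      coeffForm_coeffDeriv_affinePoint hx hs he hW hD (hs' a), hH, hH]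
    simp only [sum_lie, lie_sum, smul_lie, lie_smul, map_sum, map_smul, Matrix.mul_apply,
      Matrix.of_apply, Matrix.map_apply, Matrix.transpose_apply, smul_eq_mul]
    congr 1
    exact Finset.sum_congr rfl fun _ _ => mul_comm _ _
  exact exists_derivation_det_eq_smul D M _ _ hE

/-- The tangent lifts of the `Z i` are `Z i - ∑ d, (B C⁻¹) i d • b d`, with coefficients in any ring
over which the block `C` is invertible. -/
lemma exists_lift_of_isUnit_det {p : ℕ} (y : R ⊗[ℂ] 𝔤) (Z : Fin k → 𝔤) (b : Fin p → 𝔤)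
    (hC : IsUnit (coeffPoissonMatrix y b).det) :
    ∃ c : Fin k → Fin p → R, ∀ i a,
      coeffForm R 𝔤 y ⁅(1 : R) ⊗ₜ[ℂ] Z i + ∑ d, c i d ⊗ₜ[ℂ] b d, (1 : R) ⊗ₜ[ℂ] b a⁆ = 0 := by
  let B : Matrix (Fin k) (Fin p) R :=
    Matrix.of fun i a => coeffForm R 𝔤 y ⁅(1 : R) ⊗ₜ[ℂ] Z i, (1 : R) ⊗ₜ[ℂ] b a⁆
  refine ⟨-(B * (coeffPoissonMatrix y b)⁻¹), fun i a => ?_⟩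
  have h1 : B + -(B * (coeffPoissonMatrix y b)⁻¹) * coeffPoissonMatrix y b = 0 := by
    rw [Matrix.neg_mul, Matrix.nonsing_inv_mul_cancel_right _ _ hC, add_neg_cancel]
  have h2 := congrFun (congrFun h1 i) a
  rw [Matrix.add_apply, Matrix.mul_apply] at h2
  have h3 : ∀ r : R, ∀ u : 𝔤, r ⊗ₜ[ℂ] u = r • (1 : R) ⊗ₜ[ℂ] u := fun r u => by
    rw [TensorProduct.smul_tmul', smul_eq_mul, mul_one]
  rw [add_lie, map_add, sum_lie, map_sum, ← Matrix.zero_apply i a, ← h2]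
  congr 1
  refine Finset.sum_congr rfl fun d _ => ?_
  rw [h3, smul_lie, map_smul, smul_eq_mul]
  rfl

/-- `W` is dual to `Z` and orthogonal to `𝔫`. -/
structure IsDualFamily (𝔫 : Submodule ℂ 𝔤) (Z W : Fin k → 𝔤) : Prop where
  mem_perp : ∀ i, W i ∈ perp 𝔫
  dual : ∀ i j, killingForm ℂ 𝔤 (W i) (Z j) = if i = j then 1 else 0

/-- If `D (q j) = ⟨y | [ξ i, ξ j]⟩`, then the velocity of `y = x + ∑ j, q j • W j` under `D` is
`[y, ξ i]`. -/
lemma coeffDeriv_affinePoint_eq_lie [FiniteDimensional ℂ 𝔤] [LieAlgebra.IsSemisimple ℂ 𝔤]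
    (hZ : Submodule.span ℂ (Set.range Z) ⊔ 𝔫 = ⊤)
    (hW : IsDualFamily 𝔫 Z W) (hξ : IsTangentLift 𝔫 (affinePoint x W q) Z ξ) (i : Fin k)
    (hD : ∀ j, D (q j) = liftMatrix (affinePoint x W q) ξ i j) :
    coeffDeriv 𝔤 D (affinePoint x W q) = ⁅affinePoint x W q, ξ i⁆ := by
  rw [← sub_eq_zero]
  refine eq_zero_of_coeffForm_right fun u => ?_
  set w := coeffDeriv 𝔤 D (affinePoint x W q) - ⁅affinePoint x W q, ξ i⁆ with hw
  have hwu : ∀ u : 𝔤, coeffForm R 𝔤 w (1 ⊗ₜ u)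
      = ∑ j, killingForm ℂ 𝔤 (W j) u • liftMatrix (affinePoint x W q) ξ i j
        - coeffForm R 𝔤 (affinePoint x W q) ⁅ξ i, (1 : R) ⊗ₜ[ℂ] u⁆ := by
    intro u
    rw [hw, coeffDeriv_affinePoint, map_sub, LinearMap.sub_apply, coeffForm_lie, map_sum,
      LinearMap.sum_apply]
    simp only [coeffForm_tmul, mul_one, hD]
  let K : Submodule ℂ 𝔤 := LinearMap.ker
    (((coeffForm R 𝔤 w).restrictScalars ℂ) ∘ₗ TensorProduct.mk ℂ R 𝔤 1)
  have hK : Submodule.span ℂ (Set.range Z) ⊔ 𝔫 ≤ K := by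
    refine sup_le (Submodule.span_le.2 ?_) fun v hv => ?_
    · rintro _ ⟨j, rfl⟩
      change coeffForm R 𝔤 w (1 ⊗ₜ Z j) = 0
      rw [hwu, ← hξ.liftMatrix_eq]
      simp [hW.dual]
    · change coeffForm R 𝔤 w (1 ⊗ₜ v) = 0
      rw [hwu, hξ.form_lie i v hv, sub_zero]
      refine Finset.sum_eq_zero fun j _ => ?_
      rw [killingForm_comm, hW.mem_perp j v hv, zero_smul]
  rw [hZ] at hK
  exact hK Submodule.mem_top

lemma liftMatrix_jacobi {y : R ⊗[ℂ] 𝔤} (hξ : IsTangentLift 𝔫 y Z ξ)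
    {D : Fin k → Derivation ℂ R R} (hD : ∀ i, coeffDeriv 𝔤 (D i) y = ⁅y, ξ i⁆) (i j l : Fin k) :
    D i (liftMatrix y ξ j l) + D j (liftMatrix y ξ l i) + D l (liftMatrix y ξ i j) = 0 := by
  simp only [hξ.derivation_liftMatrix, hD, coeffForm_lie]
  rw [← map_add, ← map_add, lie_jacobi, map_zero]

end GenericPoint

/-! ### Bases adapted to the slice -/

section Slice

variable {𝔤 : Type*} [LieRing 𝔤] [LieAlgebra ℂ 𝔤] {k m : ℕ} {x s e h : 𝔤}
  {𝔫 𝔫e N : Submodule ℂ 𝔤} {n : Fin k → ℕ}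

lemma span_range_coe_basis {ι : Type*} {V : Submodule ℂ 𝔤} (Z : Module.Basis ι ℂ V) :
    Submodule.span ℂ (Set.range fun i => (Z i : 𝔤)) = V := by
  rw [show (fun i => (Z i : 𝔤)) = V.subtype ∘ Z from rfl, Set.range_comp, Submodule.span_image,
    Z.span_eq, Submodule.map_subtype_top]

lemma lie_mem_sup {N N' : Submodule ℂ 𝔤} (hN : ∀ u ∈ N, ⁅h, u⁆ ∈ N)
    (hN' : ∀ u ∈ N', ⁅h, u⁆ ∈ N') : ∀ u ∈ N ⊔ N', ⁅h, u⁆ ∈ N ⊔ N' := by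
  intro u hu
  obtain ⟨a, ha, b, hb, rfl⟩ := Submodule.mem_sup.1 hu
  rw [lie_add]
  exact Submodule.add_mem_sup (hN a ha) (hN' b hb)

/-- If `⟨x | [·, ·]⟩` restricted to `N` has its kernel in `𝔤(x)` and `N ∩ 𝔤(x) = 0`, then it is
nondegenerate on `N`. -/
lemma isUnit_det_poissonMatrix (X : Module.Basis (Fin m) ℂ N) (hN : Disjoint (centralizer x) N)
    (hker : ∀ u ∈ N, (∀ v ∈ N, killingForm ℂ 𝔤 x ⁅u, v⁆ = 0) → ⁅x, u⁆ = 0) :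
    IsUnit (poissonMatrix x (fun a => (X a : 𝔤)) (fun a => (X a : 𝔤))).det := by
  rw [isUnit_iff_ne_zero]
  intro hdet
  obtain ⟨c, hc, hc0⟩ := Matrix.exists_vecMul_eq_zero_iff.2 hdet
  let u : N := ∑ a, c a • X a
  have hu : ∀ b, killingForm ℂ 𝔤 x ⁅(u : 𝔤), (X b : 𝔤)⁆ = 0 := by
    intro b
    have := congrFun hc0 b
    simpa [u, Matrix.vecMul, dotProduct, poissonMatrix, sum_lie] using this
  have hu' : ∀ v ∈ N, killingForm ℂ 𝔤 x ⁅(u : 𝔤), v⁆ = 0 := by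
    intro v hv
    have := congrArg Subtype.val (X.sum_repr ⟨v, hv⟩)
    simp only [Submodule.coe_sum, Submodule.coe_smul] at this
    rw [← this, lie_sum, map_sum]
    refine Finset.sum_eq_zero fun b _ => ?_
    rw [lie_smul, map_smul, hu, smul_zero]
  have hu0 : (u : 𝔤) = 0 := (Submodule.disjoint_def.1 hN) u (hker u u.2 hu') u.2
  have h1 := Fintype.linearIndependent_iff.1 X.linearIndependent c (Subtype.ext hu0)
  exact hc (funext h1)

lemma killingForm_lie_of_mem_centralizer {v : 𝔤} (hv : v ∈ centralizer x) (u : 𝔤) :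
    killingForm ℂ 𝔤 x ⁅u, v⁆ = 0 := by
  rw [← lie_skew, map_neg, ← killingForm_lie, mem_centralizer.1 hv, map_zero,
    LinearMap.zero_apply, neg_zero]

variable [FiniteDimensional ℂ 𝔤] [LieAlgebra.IsSemisimple ℂ 𝔤]

lemma eq_zero_of_killingForm_span {Z : Fin k → 𝔤}
    (hZ : Submodule.span ℂ (Set.range Z) ⊔ 𝔫 = ⊤) {w : 𝔤}
    (h1 : ∀ j, killingForm ℂ 𝔤 w (Z j) = 0) (h2 : ∀ v ∈ 𝔫, killingForm ℂ 𝔤 w v = 0) : w = 0 := by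
  refine eq_zero_of_killingForm_right fun u => ?_
  have hK : Submodule.span ℂ (Set.range Z) ⊔ 𝔫 ≤ LinearMap.ker (killingForm ℂ 𝔤 w) := by
    refine sup_le (Submodule.span_le.2 ?_) fun v hv => h2 v hv
    rintro _ ⟨j, rfl⟩
    exact h1 j
  rw [hZ] at hK
  exact hK Submodule.mem_top

lemma exists_isDualFamily {V : Submodule ℂ 𝔤} (hV : IsCompl V 𝔫)
    (Z : Module.Basis (Fin k) ℂ V) : ∃ W, IsDualFamily 𝔫 (fun i => (Z i : 𝔤)) W := by
  refine ⟨fun i => ((killingForm ℂ 𝔤).toDual killingForm_nondegenerate).symm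
    (Z.coord i ∘ₗ V.projectionOnto 𝔫 hV), ⟨fun i v hv => ?_, fun i j => ?_⟩⟩
  · rw [killingForm_comm, LinearMap.BilinForm.apply_toDual_symm_apply, LinearMap.comp_apply,
      (Submodule.projectionOnto_apply_eq_zero_iff hV).2 hv, map_zero]
  · rw [LinearMap.BilinForm.apply_toDual_symm_apply, LinearMap.comp_apply,
      Submodule.projectionOnto_apply_left, Module.Basis.coord_apply, Z.repr_self,
      Finsupp.single_apply]
    simp [eq_comm]

namespace IsDualFamily

variable {Z W : Fin k → 𝔤}

lemma lie_eq (hW : IsDualFamily 𝔫 Z W) (hZ : Submodule.span ℂ (Set.range Z) ⊔ 𝔫 = ⊤)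
    (hn : ∀ i, ⁅h, Z i⁆ = (n i : ℂ) • Z i) (h𝔫 : ∀ u ∈ 𝔫, ⁅h, u⁆ ∈ 𝔫) (i : Fin k) :
    ⁅h, W i⁆ = -((n i : ℂ) • W i) := by
  rw [← sub_eq_zero]
  have key : ∀ u, killingForm ℂ 𝔤 (⁅h, W i⁆ - -((n i : ℂ) • W i)) u
      = -killingForm ℂ 𝔤 (W i) ⁅h, u⁆ + n i * killingForm ℂ 𝔤 (W i) u := by
    intro u
    rw [← lie_skew, map_sub, LinearMap.sub_apply, map_neg, LinearMap.neg_apply, killingForm_lie,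
      map_neg, LinearMap.neg_apply, map_smul, LinearMap.smul_apply, smul_eq_mul, sub_neg_eq_add]
  refine eq_zero_of_killingForm_span hZ (fun j => ?_) fun v hv => ?_
  · rw [key, hn, map_smul, hW.dual, smul_eq_mul]
    split_ifs with hij
    · rw [hij]; ring
    · ring
  · rw [key, killingForm_comm, hW.mem_perp i _ (h𝔫 v hv), killingForm_comm, hW.mem_perp i v hv]
    ring

/-- The coordinates `q i` parametrize the slice as `x + ∑ i, q i • W i`. -/
lemma eq_add_sum_coord (hW : IsDualFamily 𝔫 Z W)
    (hZ : Submodule.span ℂ (Set.range Z) ⊔ 𝔫 = ⊤) {y : 𝔤} (hy : y ∈ slice x 𝔫) :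
    y = x + ∑ i, coord x Z y i • W i := by
  have hy' : y - x ∈ perp 𝔫 := by
    simpa [slice, AffineSubspace.mem_mk'] using hy
  rw [← sub_eq_iff_eq_add', ← sub_eq_zero]
  refine eq_zero_of_killingForm_span hZ (fun j => ?_) fun v hv => ?_
  · simp [hW.dual, coord]
  · rw [map_sub, LinearMap.sub_apply, killingForm_comm, hy' v hv, map_sum, LinearMap.sum_apply,
      zero_sub, neg_eq_zero]
    refine Finset.sum_eq_zero fun i _ => ?_
    rw [map_smul, LinearMap.smul_apply, killingForm_comm, hW.mem_perp i v hv, smul_zero]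

end IsDualFamily

end Slice

/-! ### Reduction to the centralizer of the semisimple part -/

section Reduction

open scoped TensorProduct

variable {𝔤 : Type*} [LieRing 𝔤] [LieAlgebra ℂ 𝔤] {R : Type*} [CommRing R] [Algebra ℂ R]
  {k p : ℕ} {s : 𝔤} {𝔫e : Submodule ℂ 𝔤} {y : R ⊗[ℂ] 𝔤} {Z : Fin k → 𝔤}

/-- For `y` and `ξ` in `𝔤(s)`, the vector `[y, ξ]` is orthogonal to `[s, 𝔤]`. -/
lemma coeffForm_lie_orbitTangent {ξ : R ⊗[ℂ] 𝔤} (hy : ⁅(1 : R) ⊗ₜ[ℂ] s, y⁆ = 0)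
    (hξ : ⁅(1 : R) ⊗ₜ[ℂ] s, ξ⁆ = 0) {u : 𝔤} (hu : u ∈ orbitTangent s) :
    coeffForm R 𝔤 y ⁅ξ, (1 : R) ⊗ₜ[ℂ] u⁆ = 0 := by
  obtain ⟨w, rfl⟩ := hu
  have h1 : (1 : R) ⊗ₜ[ℂ] (LieAlgebra.ad ℂ 𝔤 s w) = ⁅(1 : R) ⊗ₜ[ℂ] s, (1 : R) ⊗ₜ[ℂ] w⁆ := by
    rw [LieAlgebra.ExtendScalars.bracket_tmul, mul_one]
    rfl
  have h2 : ⁅⁅y, ξ⁆, (1 : R) ⊗ₜ[ℂ] s⁆ = 0 := by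
    rw [← lie_skew, leibniz_lie, hy, hξ, zero_lie, lie_zero, add_zero, neg_zero]
  change coeffForm R 𝔤 y ⁅ξ, (1 : R) ⊗ₜ[ℂ] (LieAlgebra.ad ℂ 𝔤 s w)⁆ = 0
  rw [h1, ← coeffForm_lie, ← coeffForm_lie, h2, map_zero, LinearMap.zero_apply]

/-- For `y` in `𝔤(s)`, tangent lifts relative to `[s, 𝔤] ⊕ 𝔫e` are obtained by inverting only the
block of the Poisson matrix that belongs to `𝔫e`. -/
lemma exists_isTangentLift (hy : ⁅(1 : R) ⊗ₜ[ℂ] s, y⁆ = 0) (hZ : ∀ i, Z i ∈ centralizer s)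
    (h𝔫e : 𝔫e ≤ centralizer s) (b : Module.Basis (Fin p) ℂ 𝔫e)
    (hC : IsUnit (coeffPoissonMatrix y fun a => (b a : 𝔤)).det) :
    ∃ ξ, IsTangentLift (orbitTangent s ⊔ 𝔫e) y Z ξ ∧ ∀ i, ⁅(1 : R) ⊗ₜ[ℂ] s, ξ i⁆ = 0 := by
  obtain ⟨c, hc⟩ := exists_lift_of_isUnit_det y Z _ hC
  have hmem : ∀ {N : Submodule ℂ 𝔤}, 𝔫e ≤ N → ∀ i,
      ∑ d, c i d ⊗ₜ[ℂ] (b d : 𝔤) ∈ N.baseChange R := fun hN i =>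
    sum_mem fun d _ => Submodule.tmul_mem_baseChange_of_mem _ (hN (b d).2)
  have hs : ∀ i, ⁅(1 : R) ⊗ₜ[ℂ] s, (1 : R) ⊗ₜ[ℂ] Z i + ∑ d, c i d ⊗ₜ[ℂ] (b d : 𝔤)⁆ = 0 := fun i =>
    lie_eq_zero_of_mem_baseChange le_rfl
      (add_mem (Submodule.tmul_mem_baseChange_of_mem _ (hZ i)) (hmem h𝔫e i))
  refine ⟨_, ⟨fun i => ?_, fun i u hu => ?_⟩, hs⟩
  · rw [add_sub_cancel_left]
    exact hmem le_sup_right i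
  · obtain ⟨v, hv, w, hw, rfl⟩ := Submodule.mem_sup.1 hu
    have h1 := congrArg Subtype.val (b.sum_repr ⟨w, hw⟩)
    simp only [Submodule.coe_sum, Submodule.coe_smul] at h1
    rw [TensorProduct.tmul_add, lie_add, map_add, coeffForm_lie_orbitTangent hy (hs i) hv,
      zero_add, ← h1, TensorProduct.tmul_sum, lie_sum, map_sum]
    refine Finset.sum_eq_zero fun a _ => ?_
    rw [TensorProduct.tmul_smul, ← algebraMap_smul R, lie_smul, map_smul, hc, smul_zero]

end Reduction

/-! ### The transverse Poisson structure -/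

section Transverse

open scoped TensorProduct

variable {𝔤 : Type*} [LieRing 𝔤] [LieAlgebra ℂ 𝔤] [FiniteDimensional ℂ 𝔤]
  [LieAlgebra.IsSemisimple ℂ 𝔤] {k m : ℕ} {x s e h : 𝔤} {𝔫e 𝔫 : Submodule ℂ 𝔤}

/-- The kernel of `⟨x | [·, ·]⟩` on `𝔤` is `𝔤(x)`, so it can be tested on a complement of
`𝔤(x)`. -/
lemma lie_eq_zero_of_form_lie_eq_zero (hcompl : IsCompl (centralizer x) 𝔫) {u : 𝔤}
    (hu : ∀ v ∈ 𝔫, killingForm ℂ 𝔤 x ⁅u, v⁆ = 0) : ⁅x, u⁆ = 0 := by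
  refine eq_zero_of_killingForm_right fun v => ?_
  obtain ⟨a, ha, b, hb, rfl⟩ := Submodule.mem_sup.1
    (hcompl.sup_eq_top.symm ▸ Submodule.mem_top : v ∈ centralizer x ⊔ 𝔫)
  rw [killingForm_lie, lie_add, map_add, killingForm_lie_of_mem_centralizer ha, hu b hb, add_zero]

/-- The transverse Poisson structure on `x + 𝔫^⊥`. Its Poisson matrix is `⟨y | [ξ i, ξ j]⟩`, where
`y` is the generic point of the slice and the lifts `ξ i ∈ Z i + 𝔫e` have polynomial coefficients,
since the block of the Poisson matrix on `𝔫e` has a constant determinant. -/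
lemma exists_polynomialPoisson (hx : x = s + e) (hhs : ⁅h, s⁆ = 0) (he : ⁅h, e⁆ = (2 : ℂ) • e)
    (hle : centralizer x ≤ centralizer s) (hse : ⁅s, e⁆ = 0) (h𝔫e : 𝔫e ≤ centralizer s)
    (hinv : ∀ u ∈ 𝔫e, ⁅h, u⁆ ∈ 𝔫e) (h𝔫 : 𝔫 = orbitTangent s ⊔ 𝔫e)
    (hcompl : IsCompl (centralizer x) 𝔫)
    (Z : Module.Basis (Fin k) ℂ (centralizer x)) (X : Module.Basis (Fin m) ℂ 𝔫) (n : Fin k → ℕ)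
    (hn : ∀ i, ⁅h, (Z i : 𝔤)⁆ = (n i : ℂ) • (Z i : 𝔤)) :
    ∃ P : PolynomialPoisson k,
      P.IsTransverse x 𝔫 (fun i => (Z i : 𝔤)) (fun j => (X j : 𝔤)) ∧
      P.IsQuasiHomogeneous (fun i => n i + 2) (-2) := by
  have hsx : x ∈ centralizer s := by
    rw [mem_centralizer, hx, lie_add, lie_self, hse, add_zero]
  have hsh : ⁅s, h⁆ = 0 := by rw [← lie_skew, hhs, neg_zero]
  have hZ : Submodule.span ℂ (Set.range fun i => (Z i : 𝔤)) ⊔ 𝔫 = ⊤ := by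
    rw [span_range_coe_basis, hcompl.sup_eq_top]
  have hinv𝔫 : ∀ u ∈ 𝔫, ⁅h, u⁆ ∈ 𝔫 := by
    rw [h𝔫]
    refine lie_mem_sup (fun u hu => ?_) hinv
    rw [← perp_centralizer] at hu ⊢
    exact lie_mem_perp (fun v hv => lie_mem_centralizer hsh hv) hu
  obtain ⟨W, hW⟩ := exists_isDualFamily hcompl Z
  have hWs : ∀ i, W i ∈ centralizer s := by
    intro i
    rw [← perp_orbitTangent]
    refine LinearMap.BilinForm.orthogonal_le ?_ (hW.mem_perp i)
    rw [h𝔫]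
    exact le_sup_left
  have hWn := hW.lie_eq hZ hn hinv𝔫
  let y : MvPolynomial (Fin k) ℂ ⊗[ℂ] 𝔤 := affinePoint x W MvPolynomial.X
  have hys : ⁅(1 : MvPolynomial (Fin k) ℂ) ⊗ₜ[ℂ] s, y⁆ = 0 :=
    lie_eq_zero_of_mem_baseChange le_rfl
      (add_mem (Submodule.tmul_mem_baseChange_of_mem _ hsx)
        (sum_mem fun i _ => Submodule.tmul_mem_baseChange_of_mem _ (hWs i)))
  have hE : ∀ i, euler (fun i => n i + 2) (MvPolynomial.X i)
      = (n i + 2 : ℂ) • (MvPolynomial.X i : MvPolynomial (Fin k) ℂ) := fun i => by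
    rw [euler_X]; push_cast; rfl
  -- `⟨x | [·, ·]⟩` stays nondegenerate on `𝔫e`, as `𝔫e` and `[s, 𝔤]` are orthogonal for it.
  have hxe : ∀ u ∈ 𝔫e, (∀ v ∈ 𝔫e, killingForm ℂ 𝔤 x ⁅u, v⁆ = 0) → ⁅x, u⁆ = 0 := by
    intro u hu huv
    refine lie_eq_zero_of_form_lie_eq_zero hcompl fun v hv => ?_
    rw [h𝔫] at hv
    obtain ⟨a, ha, b, hb, rfl⟩ := Submodule.mem_sup.1 hv
    rw [lie_add, map_add, huv b hb, add_zero, ← killingForm_lie]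
    have hxu : ⁅x, u⁆ ∈ centralizer s := by
      rw [mem_centralizer, leibniz_lie, mem_centralizer.1 hsx, mem_centralizer.1 (h𝔫e hu),
        zero_lie, lie_zero, add_zero]
    rw [← perp_centralizer] at ha
    exact ha _ hxu
  let b := Module.finBasis ℂ 𝔫e
  have hCe : IsUnit (coeffPoissonMatrix y fun a => (b a : 𝔤)).det := by
    obtain ⟨c, hc⟩ := exists_derivation_det_coeffPoissonMatrix hx hhs he hWn hE b hinv h𝔫e
    refine isUnit_of_euler (fun i => Nat.succ_pos _) hc ?_
    have h0 := isUnit_det_poissonMatrix b (hcompl.disjoint.mono_right (h𝔫 ▸ le_sup_right)) hxe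
    have h1 : (MvPolynomial.aeval (0 : Fin k → ℂ)) (coeffPoissonMatrix y fun a => (b a : 𝔤)).det
        = (poissonMatrix x (fun a => (b a : 𝔤)) (fun a => (b a : 𝔤))).det := by
      rw [AlgHom.map_det, AlgHom.mapMatrix_apply, coeffPoissonMatrix_map, coeffEval_affinePoint]
      simp
    rw [← MvPolynomial.eval_zero, ← MvPolynomial.coe_aeval_eq_eval]
    exact h1 ▸ h0.ne_zero
  obtain ⟨ξ, hξ, hξs⟩ := exists_isTangentLift hys (fun i => hle (Z i).2) h𝔫e b hCe
  rw [← h𝔫] at hξ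
  have hD : ∀ i, coeffDeriv 𝔤 (hamiltonian (liftMatrix y ξ) (MvPolynomial.X i)) y = ⁅y, ξ i⁆ :=
    fun i => coeffDeriv_affinePoint_eq_lie hZ hW hξ i fun j => matrixBracket_X_X i j
  refine ⟨PolynomialPoisson.ofMatrix (liftMatrix y ξ) (liftMatrix_skew y ξ)
    (liftMatrix_jacobi hξ hD), ⟨?_, fun z hz hCz i j => ?_⟩, ?_⟩
  · exact isUnit_det_poissonMatrix X hcompl.disjoint fun u _ =>
      lie_eq_zero_of_form_lie_eq_zero hcompl
  · -- Evaluation at a point `z` of the slice turns the `ξ i` into tangent lifts at `z`, which are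
    -- unique when `C` is invertible at `z`.
    let φ : MvPolynomial (Fin k) ℂ →ₐ[ℂ] ℂ := MvPolynomial.aeval (coord x (fun i => (Z i : 𝔤)) z)
    have hz' : coeffEval 𝔤 φ y = z := by
      rw [coeffEval_affinePoint]
      simp only [φ, MvPolynomial.aeval_X]
      exact (hW.eq_add_sum_coord hZ hz).symm
    change MvPolynomial.eval _ (matrixBracket (liftMatrix y ξ) _ _) = _
    rw [matrixBracket_X_X, ← MvPolynomial.coe_aeval_eq_eval]
    change φ (coeffForm _ 𝔤 y ⁅ξ i, ξ j⁆) = _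
    rw [apply_coeffForm, coeffEval_lie, hz']
    refine diracMatrix_eq_of_lie_eq_zero (ξ := fun i => coeffEval 𝔤 φ (ξ i)) (fun i => ?_)
      (fun i a => ?_) hCz i j
    · rw [span_range_coe_basis]
      simpa [coeffEval_tmul] using coeffEval_mem φ (hξ.sub_mem i)
    · have := congrArg φ (hξ.form_lie i (X a) (X a).2)
      rwa [apply_coeffForm, coeffEval_lie, hz', coeffEval_tmul, map_one, one_smul, map_zero] at this
  · refine isQuasiHomogeneous_ofMatrix _ _ fun i j => ?_
    refine isWeightedHomogeneous_of_euler (ν := fun i => n i + 2) ?_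
    rw [derivation_liftMatrix_of_weight hx hhs he hWn hE hn hinv𝔫 hξ hξs]
    congr 1
    push_cast
    ring

end Transverse

end TransversePoisson

theorem mainTheorem5
    {𝔤 : Type*} [LieRing 𝔤] [LieAlgebra ℂ 𝔤] [FiniteDimensional ℂ 𝔤]
    [LieAlgebra.IsSemisimple ℂ 𝔤]
    (x s e h f : 𝔤)
    (hx : TransversePoisson.IsJordanDecomposition x s e)
    (ht : TransversePoisson.IsTriple h e f)
    (hsh : ⁅s, h⁆ = 0) (hsf : ⁅s, f⁆ = 0)
    (𝔫s 𝔫e 𝔫 : Submodule ℂ 𝔤)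
    (h_ns : 𝔫s = TransversePoisson.perp (TransversePoisson.centralizer s))
    (h_ne : TransversePoisson.IsInvariantComplement s x h 𝔫e)
    (h_n : 𝔫 = 𝔫s ⊔ 𝔫e) :
    -- `𝔫` is the direct sum of `𝔫s` and `𝔫e`, and is a complement of `𝔤(x)` in `𝔤`
    Disjoint 𝔫s 𝔫e ∧ IsCompl (TransversePoisson.centralizer x) 𝔫 ∧
    -- `x + 𝔫^⊥` is a transverse slice to the adjoint orbit of `x`
    TransversePoisson.IsTransverseSlice x (TransversePoisson.slice x 𝔫) ∧
    -- `𝔤(x)` has a basis of weight vectors, with natural numbers as weights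
    (∃ (k : ℕ) (Z : Module.Basis (Fin k) ℂ (TransversePoisson.centralizer x)) (n : Fin k → ℕ),
      ∀ i, ⁅h, (Z i : 𝔤)⁆ = (n i : ℂ) • (Z i : 𝔤)) ∧
    -- in the coordinates given by any such basis, the transverse Poisson structure is polynomial
    -- and quasi-homogeneous of quasi-degree `-2`
    (∀ (k m : ℕ) (Z : Module.Basis (Fin k) ℂ (TransversePoisson.centralizer x))
      (X : Module.Basis (Fin m) ℂ 𝔫) (n : Fin k → ℕ),
      (∀ i, ⁅h, (Z i : 𝔤)⁆ = (n i : ℂ) • (Z i : 𝔤)) →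
      ∃ P : TransversePoisson.PolynomialPoisson k,
        P.IsTransverse x 𝔫 (fun i => (Z i : 𝔤)) (fun j => (X j : 𝔤)) ∧
        P.IsQuasiHomogeneous (fun i => n i + 2) (-2)) := by
  have hle : TransversePoisson.centralizer x ≤ TransversePoisson.centralizer s :=
    h_ne.sup_eq ▸ le_sup_left
  have hes : 𝔫e ≤ TransversePoisson.centralizer s := h_ne.sup_eq ▸ le_sup_right
  have hhs : ⁅h, s⁆ = 0 := by rw [← lie_skew, hsh, neg_zero]
  rw [TransversePoisson.perp_centralizer] at h_ns
  have hs : IsCompl (TransversePoisson.centralizer s) 𝔫s :=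
    h_ns ▸ TransversePoisson.isCompl_centralizer_orbitTangent hx.semisimple
  have hcompl : IsCompl (TransversePoisson.centralizer x) 𝔫 := by
    rw [h_n, sup_comm]
    refine ⟨h_ne.disjoint.disjoint_sup_right_of_disjoint_sup_left
      (h_ne.sup_eq ▸ hs.disjoint), ?_⟩
    rw [codisjoint_iff, ← sup_assoc, h_ne.sup_eq, hs.sup_eq_top]
  refine ⟨(hs.disjoint.mono_left hes).symm, hcompl, ⟨AffineSubspace.self_mem_mk' _ _, ?_⟩,
    TransversePoisson.exists_weight_basis_centralizer hx.eq_add ht hsh hle, ?_⟩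
  · rw [TransversePoisson.slice, AffineSubspace.direction_mk',
      ← TransversePoisson.perp_centralizer]
    exact TransversePoisson.isCompl_perp hcompl
  · intro k m Z X n hn
    exact TransversePoisson.exists_polynomialPoisson hx.eq_add hhs ht.lie_h_e hle hx.commute hes
      h_ne.lie_mem (h_ns ▸ h_n) hcompl Z X n hn
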